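/- Let $p$ be an odd prime, let $k=\overline{\mathbb F}_p$, let $h\ge 0$, and let $R(X)=\sum_{i=0}^h a_iX^{p^i}\in k[X]$ with $a_h\neq 0$. Let $C_R$ be the smooth projective curve over $k$ with affine equation $Y^p-Y=XR(X)$. There is exactly one point $\infty$ of $C_R$ that does not lie on this affine curve; let $\operatorname{Aut}^0(C_R)$ be the group of $k$-automorphisms of $C_R$ that fix $\infty$. Let $S$ be the set of all $(a,c,d)\in k^\ast\times k\times\mathbb F_p^\ast$ for which there is a polynomial $g\in k[X]$ with $(aX+c)R(aX+c)-dXR(X)=g(X)^p-g(X)$. For $(a,c,d)\in S$ and $b\in k$ with $b^p-b=cR(c)$, let $\sigma_{a,b,c,d}\in\operatorname{Aut}^0(C_R)$ be the automorphism given on the affine curve by $(x,y)\mapsto(ax+c,\;dy+b+B_c(ax))$, where $B_c\in Xk[X]$ is the polynomial with $B_c(X)^p-B_c(X)=cR(X)+R(c)X$. Then: (1) The group $\operatorname{Aut}^0(C_R)$ has a unique Sylow $p$-subgroup $P$. It consists of all the automorphisms $\sigma_{1,b,c,1}$ and has cardinality $p^{2h+1}$. (2) The automorphisms $\sigma_{a,0,0,d}$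 form a cyclic subgroup $H$ of $\operatorname{Aut}^0(C_R)$ of order $$\frac{e(p-1)}{2}\,\gcd_{0\le i\le h,\ a_i\neq 0}(p^i+1),$$ where $e=2$ if all the indices $i$ with $a_i\neq 0$ have the same parity, and $e=1$ otherwise. (3) $\operatorname{Aut}^0(C_R)$ is the (internal) semidirect product of the normal subgroup $P$ and the subgroup $H$. -/

import Mathlib

open Polynomial

namespace ASCurve

/-! ### Irreducibility of Artin–Schreier polynomials -/

theorem irreducible_artinSchreier {p : ℕ} [hp : Fact p.Prime] {F : Type*} [Field F] [CharP F p]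
    (f : F) (hf : ∀ z : F, z ^ p - z ≠ f) : Irreducible (X ^ p - X - C f : F[X]) := by
  have hp1 : 1 < p := hp.out.one_lt
  have hlow : (-(X + C f) : F[X]).degree < (p : ℕ) := by
    rw [degree_neg, degree_X_add_C]
    exact_mod_cast hp1
  have heq : (X ^ p - X - C f : F[X]) = X ^ p + -(X + C f) := by ring
  have hdeg : (X ^ p - X - C f : F[X]).natDegree = p := by
    rw [heq]
    rw [natDegree_add_eq_left_of_degree_lt (by rwa [degree_X_pow]), natDegree_X_pow]
  have hmon : (X ^ p - X - C f : F[X]).Monic := by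
    rw [heq]
    exact monic_X_pow_add hlow
  rw [hmon.irreducible_iff_natDegree']
  refine ⟨fun h => by rw [h, natDegree_one] at hdeg; omega, ?_⟩
  intro u g hu hg hug hmem
  rw [hdeg, Finset.mem_Ioc] at hmem
  let L := AlgebraicClosure F
  have : CharP L p := charP_of_injective_algebraMap (algebraMap F L).injective p
  have hroot : ∀ z ∈ (g.map (algebraMap F L)).roots, z ^ p - z = algebraMap F L f := by
    intro z hz
    rw [mem_roots (hg.map _).ne_zero, IsRoot.def, eval_map_algebraMap] at hz
    have h := congrArg (aeval z) hug
    rw [map_mul, hz, mul_zero] at h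
    simp only [map_sub, map_pow, aeval_X, aeval_C] at h
    linear_combination -h
  have hsp : (g.map (algebraMap F L)).Splits := IsAlgClosed.splits _
  have hcard := hsp.natDegree_eq_card_roots
  rw [natDegree_map] at hcard
  obtain ⟨y, hy⟩ := Multiset.card_pos_iff_exists_mem.mp (hcard ▸ hmem.1)
  have hyr := hroot y hy
  have key : ∀ s : Multiset L, (∀ z ∈ s, z ^ p - z = algebraMap F L f) →
      s.sum - (Multiset.card s : L) * y ∈ (algebraMap F L).fieldRange := by
    intro s
    induction s using Multiset.induction_on with
    | empty => intro _; simp [zero_mem]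
    | cons z s ih =>
      intro hs
      have h1 := ih (fun w hw => hs w (Multiset.mem_cons_of_mem hw))
      have h2 : z - y ∈ (algebraMap F L).fieldRange := by
        refine (bot_le : (⊥ : Subfield L) ≤ _) ?_
        rw [Subfield.mem_bot_iff_pow_eq_self (F := L) (p := p), sub_pow_expChar]
        linear_combination hs z (Multiset.mem_cons_self z s) - hyr
      have := add_mem h1 h2
      rw [Multiset.sum_cons, Multiset.card_cons]
      convert this using 1
      push_cast; ring
  have h3 := key _ hroot
  rw [← hcard] at h3
  have h4 : (g.map (algebraMap F L)).roots.sum ∈ (algebraMap F L).fieldRange := by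
    have := hsp.nextCoeff_eq_neg_sum_roots_of_monic (hg.map _)
    rw [nextCoeff_map (algebraMap F L).injective] at this
    exact ⟨- g.nextCoeff, by rw [map_neg, this, neg_neg]⟩
  have h5 := sub_mem h4 h3
  rw [sub_sub_cancel] at h5
  have hm : (g.natDegree : L) ≠ 0 := by
    rw [Ne, CharP.cast_eq_zero_iff L p]
    intro hd
    have := Nat.le_of_dvd hmem.1 hd
    omega
  have h6 : y ∈ (algebraMap F L).fieldRange := by
    have := mul_mem (inv_mem (natCast_mem (algebraMap F L).fieldRange g.natDegree)) h5
    rwa [inv_mul_cancel_left₀ hm] at this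
  obtain ⟨z, rfl⟩ := h6
  exact hf z ((algebraMap F L).injective (by simpa using hyr))

/-! ### Smooth projective curves as spaces of places of function fields

The smooth projective curve with function field `K / k` (`k` algebraically closed) is the set of
all valuation rings of `K / k` different from `K`, with the cofinite topology, the regular
functions on an open set being the elements of `K` that lie in every local ring of that set. -/

/-- A point of the smooth projective curve with function field `K` over `k`: a proper valuation
subring of `K` containing `k` (the local ring of the point). -/
structure Point (k K : Type*) [Field k] [Field K] [Algebra k K] where
  localRing : ValuationSubring K
  algebraMap_mem : ∀ c : k, algebraMap k K c ∈ localRing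
  ne_top : localRing ≠ ⊤

namespace Point

variable {k K : Type*} [Field k] [Field K] [Algebra k K]

/-- The nonempty open sets are the sets with finite complement. -/
instance : TopologicalSpace (Point k K) :=
  TopologicalSpace.cofinite

/-- The rational function `f` is defined at `P` and has there the value `v`, i.e. `f - v` lies in
the maximal ideal of the local ring of `P`. -/
def HasValue (P : Point k K) (f : K) (v : k) : Prop :=
  f - algebraMap k K v ∈ P.localRing.nonunits

/-- The function `s` is regular on `U`: on `U` it is given by the values of one element of `K`
that is defined at all points of `U`. (Only used for open sets `U`; the values of `s` outside `U`
are irrelevant.) -/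
def IsRegularOn (U : Set (Point k K)) (s : Point k K → k) : Prop :=
  ∃ f : K, ∀ P ∈ U, P.HasValue f (s P)

/-- Morphisms over `k`: continuous maps that pull back regular functions to regular functions. -/
def IsMorphism (φ : Point k K → Point k K) : Prop :=
  Continuous φ ∧ ∀ (U : Set (Point k K)) (s : Point k K → k),
    IsOpen U → IsRegularOn U s → IsRegularOn (φ ⁻¹' U) (s ∘ φ)

theorem IsMorphism.id : IsMorphism (id : Point k K → Point k K) :=
  ⟨continuous_id, fun _ _ _ h => h⟩

theorem IsMorphism.comp {φ ψ : Point k K → Point k K} (hφ : IsMorphism φ) (hψ : IsMorphism ψ) :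
    IsMorphism (φ ∘ ψ) :=
  ⟨hφ.1.comp hψ.1, fun U s hU hs => hψ.2 _ _ (hU.preimage hφ.1) (hφ.2 U s hU hs)⟩

end Point

/-- The group (under composition) of `k`-automorphisms of the smooth projective curve with
function field `K`. -/
def Aut (k K : Type*) [Field k] [Field K] [Algebra k K] : Subgroup (Equiv.Perm (Point k K)) where
  carrier := {φ | Point.IsMorphism φ ∧ Point.IsMorphism φ.symm}
  one_mem' := ⟨Point.IsMorphism.id, Point.IsMorphism.id⟩
  mul_mem' := fun h₁ h₂ => ⟨h₁.1.comp h₂.1, h₂.2.comp h₁.2⟩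
  inv_mem' := fun h => ⟨h.2, h.1⟩

/-! ### The additive polynomial `R` and the curve `Y ^ p - Y = X R(X)` -/

/-- An additive polynomial `R(X) = ∑_{i = 0}^h a i * X ^ (p ^ i)` of degree `p ^ h` over `k`. -/
structure AdditivePoly (p : ℕ) (k : Type*) [Field k] where
  h : ℕ
  a : ℕ → k
  a_ne_zero : a h ≠ 0

namespace AdditivePoly

variable {p : ℕ} {k : Type*} [Field k] (R : AdditivePoly p k)

/-- The polynomial `R(X)`. -/
noncomputable def poly : k[X] := ∑ i ∈ Finset.range (R.h + 1), C (R.a i) * X ^ (p ^ i)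

/-- The polynomial `Y ^ p - Y - X R(X)` in `Y` over `k[X]`. -/
noncomputable def equation : k[X][X] := X ^ p - X - C (X * R.poly)

/-- The affine coordinate ring `k[X, Y] / (Y ^ p - Y - X R(X))`. -/
abbrev CoordinateRing : Type _ := AdjoinRoot R.equation

/-- The function field of the curve. -/
abbrev FunctionField : Type _ := FractionRing R.CoordinateRing

theorem natDegree_X_mul_poly (hp : 1 < p) : (X * R.poly).natDegree = p ^ R.h + 1 := by
  have h0 : R.poly.natDegree = p ^ R.h := by
    rw [poly, Finset.sum_range_succ, natDegree_add_eq_right_of_degree_lt]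
    · exact natDegree_C_mul_X_pow _ _ R.a_ne_zero
    · rw [degree_C_mul_X_pow _ R.a_ne_zero]
      refine (degree_sum_le _ _).trans_lt ?_
      rw [Finset.sup_lt_iff (WithBot.bot_lt_coe _)]
      intro i hi
      refine (degree_C_mul_X_pow_le _ _).trans_lt ?_
      exact_mod_cast Nat.pow_lt_pow_right hp (Finset.mem_range.mp hi)
  rw [natDegree_X_mul, h0]
  rintro h
  rw [h, natDegree_zero] at h0
  exact (pow_pos (by omega : 0 < p) _).ne h0

theorem pow_sub_ne [hp : Fact p.Prime] [CharP k p] (z : k[X]) : z ^ p - z ≠ X * R.poly := by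
  intro hz
  have hp1 := hp.out.one_lt
  have hd := R.natDegree_X_mul_poly hp1
  have hz0 : 0 < z.natDegree := by
    by_contra h0
    rw [eq_C_of_natDegree_eq_zero (by omega : z.natDegree = 0), ← C_pow, ← C_sub] at hz
    rw [← hz, natDegree_C] at hd
    omega
  have hd2 : (z ^ p - z).natDegree = p * z.natDegree := by
    rw [natDegree_sub_eq_left_of_natDegree_lt, natDegree_pow]
    rw [natDegree_pow]
    nlinarith
  rw [hz, hd] at hd2
  by_cases hh : R.h = 0
  · rw [hh, pow_zero] at hd2
    have hp2 : p = 2 := (Nat.prime_dvd_prime_iff_eq hp.out Nat.prime_two).mp ⟨_, hd2⟩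
    subst hp2
    have h1 : z.natDegree = 1 := by omega
    have h2 : derivative (z ^ 2 - z) = 0 := by
      rw [hz, poly, hh]
      have : (2 : k[X]) = 0 := by exact_mod_cast CharP.cast_eq_zero k[X] 2
      simp only [zero_add, Finset.sum_range_one, pow_zero, pow_one, derivative_mul, derivative_X,
        derivative_C]
      linear_combination (C (R.a 0) * X) * this
    have h3 : derivative z = 0 := by
      have : (2 : k[X]) = 0 := by exact_mod_cast CharP.cast_eq_zero k[X] 2
      rw [derivative_sub, derivative_pow] at h2
      simp only [Nat.cast_ofNat, map_ofNat, this] at h2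
      linear_combination -h2
    have h4 : z.coeff 1 = 0 := by
      have := congrArg (fun q => q.coeff 0) h3
      simpa [coeff_derivative] using this
    rw [← h1, coeff_natDegree, leadingCoeff_eq_zero] at h4
    rw [h4, natDegree_zero] at h1
    omega
  · have h1 : p ∣ p ^ R.h + 1 := ⟨_, hd2⟩
    have h2 : p ∣ p ^ R.h := dvd_pow_self p hh
    have := (Nat.dvd_add_right h2).mp h1
    exact hp.out.one_lt.ne' (Nat.dvd_one.mp this)

theorem prime_equation [hp : Fact p.Prime] [CharP k p] : Prime R.equation := by
  have hp1 := hp.out.one_lt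
  have hmon : R.equation.Monic := by
    have heq : R.equation = X ^ p + -(X + C (X * R.poly)) := by rw [equation]; ring
    rw [heq]
    apply monic_X_pow_add
    rw [degree_neg, degree_X_add_C]
    exact_mod_cast hp1
  refine Irreducible.prime ?_
  rw [hmon.irreducible_iff_irreducible_map_fraction_map (K := RatFunc k)]
  simp only [equation, Polynomial.map_sub, Polynomial.map_pow, map_X, map_C]
  have : CharP (RatFunc k) p :=
    charP_of_injective_algebraMap (IsFractionRing.injective k[X] (RatFunc k)) p
  refine irreducible_artinSchreier _ ?_
  intro z hz
  have hint : IsIntegral k[X] z := by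
    refine ⟨R.equation, hmon, ?_⟩
    simp only [equation, eval₂_sub, eval₂_pow, eval₂_X, eval₂_C]
    exact sub_eq_zero.mpr hz
  obtain ⟨w, rfl⟩ := IsIntegrallyClosed.isIntegral_iff.mp hint
  refine R.pow_sub_ne w (IsFractionRing.injective k[X] (RatFunc k) ?_)
  rw [map_sub, map_pow]
  exact hz

instance [Fact p.Prime] [Algebra (ZMod p) k] : IsDomain R.CoordinateRing :=
  have : CharP k p := charP_of_injective_algebraMap (algebraMap (ZMod p) k).injective p
  AdjoinRoot.isDomain_of_prime R.prime_equation

/-- The coordinate function `x`. -/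
noncomputable def x : R.FunctionField :=
  algebraMap R.CoordinateRing R.FunctionField (AdjoinRoot.of R.equation X)

/-- The coordinate function `y`. -/
noncomputable def y : R.FunctionField :=
  algebraMap R.CoordinateRing R.FunctionField (AdjoinRoot.root R.equation)

/-- The set `S(f)` of triples `(a, c, d)` for `f = X R(X)`. -/
def S [Algebra (ZMod p) k] : Set (kˣ × k × (ZMod p)ˣ) :=
  {t | ∃ g : k[X],
    (X * R.poly).comp (C (t.1 : k) * X + C t.2.1)
      - C (algebraMap (ZMod p) k (t.2.2 : ZMod p)) * (X * R.poly) = g ^ p - g}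

/-- `B` is the polynomial `B_c`: it has no constant term and `B ^ p - B = c R(X) + R(c) X`. -/
def IsB (c : k) (B : k[X]) : Prop :=
  X ∣ B ∧ B ^ p - B = C c * R.poly + C (R.poly.eval c) * X

open Classical in
/-- The number `gcd (p ^ i + 1)`, taken over the indices `i` with `a i ≠ 0`. -/
noncomputable def gcdExp : ℕ :=
  ((Finset.range (R.h + 1)).filter fun i => R.a i ≠ 0).gcd fun i => p ^ i + 1

open Classical in
/-- `2` if all indices `i` with `a i ≠ 0` have the same parity, and `1` otherwise. -/
noncomputable def e : ℕ :=
  if ∀ i ≤ R.h, ∀ j ≤ R.h, R.a i ≠ 0 → R.a j ≠ 0 → (Even i ↔ Even j) then 2 else 1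

variable [Fact p.Prime] [Algebra (ZMod p) k]

/-- The points of the smooth projective curve `C_R`. -/
abbrev CurvePoint : Type _ := Point k R.FunctionField

/-- `P` lies on the affine curve `Y ^ p - Y = X R(X)`. -/
def IsAffine (P : R.CurvePoint) : Prop := R.x ∈ P.localRing ∧ R.y ∈ P.localRing

/-- The group of automorphisms of `C_R`. -/
noncomputable abbrev AutCurve : Subgroup (Equiv.Perm R.CurvePoint) := Aut k R.FunctionField

/-- The automorphisms of `C_R` that fix the point `Q`. -/
noncomputable abbrev AutFixing (Q : R.CurvePoint) : Subgroup R.AutCurve := MulAction.stabilizer R.AutCurve Q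

/-- `φ` is the automorphism `σ_{a,b,c,d}`, where `(a, c, d) ∈ S(X R(X))` and `b ^ p - b = c R(c)`:
on the affine curve, it is the map `(x, y) ↦ (a x + c, d y + b + B_c(a x))`. -/
def IsSigma (a : kˣ) (b c : k) (d : (ZMod p)ˣ) (φ : R.AutCurve) : Prop :=
  (a, c, d) ∈ R.S ∧ b ^ p - b = c * R.poly.eval c ∧ ∃ B : k[X], R.IsB c B ∧
    ∀ (P : R.CurvePoint) (u v : k), P.HasValue R.x u → P.HasValue R.y v →
      (φ • P).HasValue R.x (a * u + c) ∧
      (φ • P).HasValue R.y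
        (algebraMap (ZMod p) k (d : ZMod p) * v + b + B.eval (a * u))

end AdditivePoly

end ASCurve

/-! Write `A` for the coordinate ring `k[x, y] / (y^p - y - x R(x))`. An automorphism fixing the
point at infinity preserves the affine curve, hence comes from a `k`-algebra automorphism `τ` of `A`
(`exists_algEquiv`). The pole order at infinity is the weight with `x ↦ p` and `y ↦ p^h + 1`
(`valuation_algebraMap_pow`), and `τ` preserves it (`weight_algEquiv`). This forces `τ x = a x + c`
and `τ y = d y + G(x)` (`exists_algEquiv_coord`). Substituting into the equation and comparing the
coefficients of `1` and `y` gives `d^p = d` and `(ax+c)R(ax+c) - d x R(x) = G^p - G`.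

Modulo polynomials `g^p - g`, a monomial `r X^n` is equivalent to `r^p X^(pn)`. On the left of the
last equation the exponents are `p^i + 1`, `p^i` and `0`, and for odd `p` these three kinds do not
interact. So membership in `S` splits into `a^(p^i + 1) = d` whenever `a_i ≠ 0` (the group `torus`)
and the existence of `B_c` (the set `W`), while the constant term gives the equation for `b`. `W` is
the root set of a separable polynomial of degree `p^(2h)`, and each `c` admits `p` values of `b`,
whence the order `p^(2h+1)`. In the torus, the projection to `d` has as kernel the roots of unity of
order dividing the gcd; its image is all of `𝔽_p^*` if the parities agree, and the squares
otherwise.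

Finally, `σ_{a,b,c,d} ↦ (a, d)` is a homomorphism (`toTorus`) whose kernel is the `p`-group `P`. The
stabilizer of the affine point `(0, 0)` maps isomorphically onto the torus, so it is a complement of
`P`. Its order is prime to `p`, which makes `P` a normal Sylow subgroup, and it is cyclic because
`a` determines `d` and thus embeds it in `k^*`. -/

namespace ASCurve

/-! ### Polynomials of the form `g^p - g` -/

section ArtinSchreierPolynomials

theorem not_dvd_prime_pow_add_one {p : ℕ} (hp : p.Prime) (hp2 : p ≠ 2) (i : ℕ) :
    ¬ p ∣ p ^ i + 1 := by
  intro h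
  rcases Nat.eq_zero_or_pos i with rfl | hi
  · exact hp2 ((Nat.prime_dvd_prime_iff_eq hp Nat.prime_two).mp (by simpa using h))
  · exact hp.one_lt.ne' (Nat.dvd_one.mp ((Nat.dvd_add_right (dvd_pow_self p hi.ne')).mp h))

theorem coprime_prime_pow_add_one {p : ℕ} (hp : p.Prime) (hp2 : p ≠ 2) (i : ℕ) :
    p.Coprime (p ^ i + 1) :=
  (hp.coprime_iff_not_dvd).mpr (not_dvd_prime_pow_add_one hp hp2 i)

/-- Together with the next lemma, this separates the exponents `p^i + 1` from the exponents `p^l`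
under multiplication by powers of `p`. It needs `p` odd: for `p = 2` and `i = 0` the number `p^i +
1` is itself a power of `p`. -/
theorem prime_pow_add_one_mul_pow_ne {p : ℕ} (hp : p.Prime) (hp2 : p ≠ 2) (i j l : ℕ) :
    (p ^ i + 1) * p ^ j ≠ p ^ l := by
  intro h
  have h1 : p ^ i + 1 ∣ p ^ l := ⟨_, h.symm⟩
  have h2 := Nat.Coprime.eq_one_of_dvd ((coprime_prime_pow_add_one hp hp2 i).symm.pow_right l) h1
  have := pow_pos hp.pos i
  omega

theorem prime_pow_add_one_mul_pow_eq_iff {p : ℕ} (hp : p.Prime) (hp2 : p ≠ 2) (i j l : ℕ) :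
    (p ^ i + 1) * p ^ j = p ^ l + 1 ↔ j = 0 ∧ l = i := by
  constructor
  · intro h
    have hj : j = 0 := by
      by_contra hj
      exact not_dvd_prime_pow_add_one hp hp2 l
        (h ▸ (dvd_pow_self p hj).mul_left _)
    subst hj
    rw [pow_zero, mul_one, add_left_inj] at h
    exact ⟨rfl, (Nat.pow_right_injective hp.two_le h).symm⟩
  · rintro ⟨rfl, rfl⟩
    simp

variable {p : ℕ} [hp : Fact p.Prime] {k : Type*} [Field k] [CharP k p]

theorem two_ne_zero_of_charP (hp2 : p ≠ 2) : (2 : k) ≠ 0 := by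
  intro h2
  have : p ∣ 2 := (CharP.cast_eq_zero_iff k p 2).mp (by exact_mod_cast h2)
  exact hp2 ((Nat.prime_dvd_prime_iff_eq hp.out Nat.prime_two).mp this)

theorem coeff_pow_char_mul (g : k[X]) (n : ℕ) : (g ^ p).coeff (n * p) = g.coeff n ^ p := by
  rw [← map_frobenius_expand, coeff_map, coeff_expand_mul hp.out.pos, frobenius_def]

theorem coeff_pow_char_of_not_dvd (g : k[X]) {n : ℕ} (hn : ¬ p ∣ n) : (g ^ p).coeff n = 0 := by
  rw [← map_frobenius_expand, coeff_map, coeff_expand hp.out.pos, if_neg hn, map_zero]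

/-- The vanishing of the higher coefficients makes the coefficient of `g` at `n p^j` the `p^j`-th
power of the one at `n`. As `g` has finite degree, that one is zero; and since `p ∤ n`, the summand
`g^p` contributes nothing at `n`. -/
theorem coeff_eq_zero_of_eq_pow_sub {f g : k[X]} {n : ℕ} (hn : ¬ p ∣ n) (hfg : f = g ^ p - g)
    (hf : ∀ j, 1 ≤ j → f.coeff (n * p ^ j) = 0) : f.coeff n = 0 := by
  have h1 : ∀ j, g.coeff (n * p ^ j) = g.coeff n ^ p ^ j := by
    intro j
    induction j with
    | zero => simp
    | succ j ih =>
      have := hf (j + 1) (by omega)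
      rw [hfg, coeff_sub, pow_succ, ← mul_assoc, coeff_pow_char_mul, ih, sub_eq_zero] at this
      rw [pow_succ, ← mul_assoc, ← this, pow_mul]
  have hn0 : n ≠ 0 := by
    rintro rfl
    exact hn (dvd_zero p)
  have h2 : g.coeff n = 0 := by
    -- With this exponent, `n p^j` exceeds the degree of `g`.
    have h3 := h1 (g.natDegree + 1)
    rw [coeff_eq_zero_of_natDegree_lt] at h3
    · exact eq_zero_of_pow_eq_zero h3.symm
    · calc g.natDegree < g.natDegree + 1 := Nat.lt_succ_self _
        _ < p ^ (g.natDegree + 1) := Nat.lt_pow_self hp.out.one_lt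
        _ ≤ n * p ^ (g.natDegree + 1) := Nat.le_mul_of_pos_left _ (by omega)
  rw [hfg, coeff_sub, coeff_pow_char_of_not_dvd g hn, h2, sub_zero]

/-- Modulo `B^p - B`, each term `α X^(p^i)` can be pushed up to `α^(p^(n-i)) X^(p^n)`, so an
additive polynomial reduces to a single monomial. -/
theorem exists_eq_pow_sub_add (α : ℕ → k) (n : ℕ) : ∃ B : k[X], X ∣ B ∧
    ∑ i ∈ Finset.range (n + 1), C (α i) * X ^ p ^ i
      = B ^ p - B + C (∑ i ∈ Finset.range (n + 1), α i ^ p ^ (n - i)) * X ^ p ^ n := by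
  induction n with
  | zero => exact ⟨0, dvd_zero _, by simp [hp.out.ne_zero]⟩
  | succ n ih =>
    obtain ⟨B, hB, h⟩ := ih
    set L := ∑ i ∈ Finset.range (n + 1), α i ^ p ^ (n - i) with hL
    -- The correction `-L X^(p^n)` turns the remainder `L X^(p^n)` into `L^p X^(p^(n+1))`.
    refine ⟨B - C L * X ^ p ^ n, dvd_sub hB
      ((dvd_pow_self X (pow_pos hp.out.pos n).ne').mul_left _), ?_⟩
    have h2 : ∑ i ∈ Finset.range (n + 1), α i ^ p ^ (n + 1 - i) = L ^ p := by
      rw [hL, sum_pow_char p]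
      refine Finset.sum_congr rfl fun i hi => ?_
      rw [← pow_mul, ← pow_succ, Nat.succ_sub (by simpa [Nat.lt_succ_iff] using hi)]
    rw [Finset.sum_range_succ, h, Finset.sum_range_succ, h2, sub_pow_char, mul_pow, ← pow_mul,
      ← pow_succ, C_add, C_pow]
    simp only [Nat.sub_self, pow_zero, pow_one]
    ring

/-- Extracting a `p`-th root of `L` lowers the monomial step by step to degree 1, where the
coefficient criterion applies. -/
theorem eq_zero_of_C_mul_X_pow_eq [IsAlgClosed k] {L : k} {n : ℕ} {g : k[X]}
    (h : C L * X ^ p ^ n = g ^ p - g) : L = 0 := by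
  induction n generalizing L g with
  | zero =>
    have := coeff_eq_zero_of_eq_pow_sub (n := 1) hp.out.not_dvd_one h (fun j hj => ?_)
    · simpa using this
    · have : 1 * p ^ j ≠ 1 := by
        rw [one_mul]
        exact (Nat.one_lt_pow (by omega) hp.out.one_lt).ne'
      rw [coeff_C_mul, coeff_X_pow, if_neg (by simpa using this), mul_zero]
  | succ n ih =>
    obtain ⟨l, rfl⟩ := IsAlgClosed.exists_pow_nat_eq L hp.out.pos
    have : l = 0 := by
      refine ih (g := g - C l * X ^ p ^ n) ?_
      rw [sub_pow_char, mul_pow, ← pow_mul, ← pow_succ, ← C_pow]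
      linear_combination h
    rw [this, zero_pow hp.out.ne_zero]

theorem exists_pow_sub_eq_iff [IsAlgClosed k] (α : ℕ → k) (n : ℕ) :
    (∃ B : k[X], X ∣ B ∧ B ^ p - B = ∑ i ∈ Finset.range (n + 1), C (α i) * X ^ p ^ i) ↔
      ∑ i ∈ Finset.range (n + 1), α i ^ p ^ (n - i) = 0 := by
  obtain ⟨B, hB, h⟩ := exists_eq_pow_sub_add (p := p) α n
  constructor
  · rintro ⟨g, -, hg⟩
    refine eq_zero_of_C_mul_X_pow_eq (p := p) (n := n) (g := g - B) ?_
    rw [sub_pow_char]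
    linear_combination -h - hg
  · intro h0
    exact ⟨B, hB, by rw [h, h0]; simp⟩

omit hp [CharP k p] in
theorem natDegree_X_pow_sub_X_sub_C (hp : 1 < p) (e : k) :
    (X ^ p - X - C e : k[X]).natDegree = p := by
  have heq : (X ^ p - X - C e : k[X]) = X ^ p + -(X + C e) := by ring
  rw [heq, natDegree_add_eq_left_of_degree_lt, natDegree_X_pow]
  rw [degree_neg, degree_X_add_C, degree_X_pow]
  exact_mod_cast hp

omit [CharP k p] in
theorem exists_pow_sub_eq [IsAlgClosed k] (e : k) : ∃ b : k, b ^ p - b = e := by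
  have hdeg := natDegree_X_pow_sub_X_sub_C hp.out.one_lt e
  obtain ⟨b, hb⟩ := IsAlgClosed.exists_root (X ^ p - X - C e) (fun h => by
    rw [natDegree_eq_of_degree_eq_some h] at hdeg
    exact hp.out.ne_zero hdeg.symm)
  simp only [IsRoot.def, eval_sub, eval_pow, eval_X, eval_C] at hb
  exact ⟨b, sub_eq_zero.mp hb⟩

theorem card_pow_sub_eq [IsAlgClosed k] (e : k) : Nat.card {b : k // b ^ p - b = e} = p := by
  have hp1 := hp.out.one_lt
  have hdeg := natDegree_X_pow_sub_X_sub_C hp1 e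
  have hne : (X ^ p - X - C e : k[X]) ≠ 0 := by
    intro h
    rw [h, natDegree_zero] at hdeg
    omega
  have hsep : (X ^ p - X - C e : k[X]).Separable := by
    rw [separable_def]
    have : derivative (X ^ p - X - C e : k[X]) = -1 := by
      simp [derivative_X_pow]
    rw [this]
    exact isCoprime_one_right.neg_right
  have h := card_rootSet_eq_natDegree (K := k) hsep (IsAlgClosed.splits _)
  rw [hdeg, ← Nat.card_eq_fintype_card] at h
  refine (Nat.card_congr (Equiv.subtypeEquivRight fun b => ?_)).trans h
  rw [mem_rootSet_of_ne hne]
  simp [sub_eq_zero]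

end ArtinSchreierPolynomials

/-! ### The defining condition of `S`, and the count of the pairs `(b, c)` -/

namespace AdditivePoly

variable {p : ℕ} [hp : Fact p.Prime] {k : Type*} [Field k] (R : AdditivePoly p k)

omit hp in
theorem eval_poly (c : k) :
    R.poly.eval c = ∑ i ∈ Finset.range (R.h + 1), R.a i * c ^ p ^ i := by
  simp [poly, eval_finsetSum]

theorem eval_poly_zero : R.poly.eval 0 = 0 := by
  simp [eval_poly, hp.out.ne_zero]

theorem comp_poly [CharP k p] (a c : k) :
    R.poly.comp (C a * X + C c) =
      ∑ i ∈ Finset.range (R.h + 1), C (R.a i * a ^ p ^ i) * X ^ p ^ i + C (R.poly.eval c) := by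
  rw [eval_poly, poly, Polynomial.sum_comp, map_sum, ← Finset.sum_add_distrib]
  refine Finset.sum_congr rfl fun i _ => ?_
  simp only [mul_comp, C_comp, pow_comp, X_comp, add_pow_char_pow, mul_pow, C_mul, C_pow]
  ring

/-- Additivity of `R` sorts the terms into exponents `p^i + 1`, exponents `p^i`, and a constant. -/
theorem X_mul_poly_comp_sub [CharP k p] (a c d : k) :
    (X * R.poly).comp (C a * X + C c) - C d * (X * R.poly) =
      ∑ i ∈ Finset.range (R.h + 1), C (R.a i * (a ^ (p ^ i + 1) - d)) * X ^ (p ^ i + 1)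
      + (C c * R.poly.comp (C a * X) + C (R.poly.eval c) * (C a * X)) + C (c * R.poly.eval c) := by
  have h1 := R.comp_poly a 0
  rw [R.eval_poly_zero, C_0, add_zero, add_zero] at h1
  have h2 : ∑ i ∈ Finset.range (R.h + 1), C (R.a i * (a ^ (p ^ i + 1) - d)) * X ^ (p ^ i + 1)
      = C a * X * R.poly.comp (C a * X) - C d * (X * R.poly) := by
    rw [h1]
    conv_rhs => rw [poly]
    simp only [Finset.mul_sum]
    rw [← Finset.sum_sub_distrib]
    refine Finset.sum_congr rfl fun i _ => ?_
    simp only [C_mul, C_sub, C_pow]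
    ring
  rw [h2, mul_comp, X_comp, comp_poly, h1, C_mul]
  ring

/-- The `c` for which `B_c` exists. -/
def W : Set k := {c | ∃ B, R.IsB c B}

/-- The coefficient criterion at `n = p^i + 1`: no number `(p^i + 1) p^j` with `j ≥ 1` occurs as an
exponent. -/
theorem pow_eq_of_eq_pow_sub [CharP k p] (hp2 : p ≠ 2) {a c d : k} {g : k[X]}
    (hg : (X * R.poly).comp (C a * X + C c) - C d * (X * R.poly) = g ^ p - g) {i : ℕ}
    (hi : i ≤ R.h) : R.a i * (a ^ (p ^ i + 1) - d) = 0 := by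
  have hp0 := hp.out
  have hcoeff : ∀ j, ((X * R.poly).comp (C a * X + C c) - C d * (X * R.poly)).coeff
      ((p ^ i + 1) * p ^ j) = if j = 0 then R.a i * (a ^ (p ^ i + 1) - d) else 0 := by
    intro j
    have h1 := R.comp_poly a 0
    rw [R.eval_poly_zero, C_0, add_zero, add_zero] at h1
    have hne1 : 1 ≠ (p ^ i + 1) * p ^ j := by
      have := prime_pow_add_one_mul_pow_ne hp0 hp2 i j 0
      rw [pow_zero] at this
      exact this.symm
    have hne0 : (p ^ i + 1) * p ^ j ≠ 0 :=
      mul_ne_zero (Nat.succ_ne_zero _) (pow_ne_zero _ hp0.ne_zero)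
    rw [X_mul_poly_comp_sub, h1, coeff_add, coeff_add, coeff_add, coeff_C_mul, coeff_C_mul,
      coeff_C_mul, coeff_X, if_neg hne1, coeff_C, if_neg hne0, finsetSum_coeff, finsetSum_coeff]
    simp only [coeff_C_mul, coeff_X_pow, prime_pow_add_one_mul_pow_ne hp0 hp2, if_false, mul_zero,
      Finset.sum_const_zero, add_zero, prime_pow_add_one_mul_pow_eq_iff hp0 hp2]
    by_cases hj : j = 0
    · simp only [hj, true_and, if_true, mul_ite, mul_one, mul_zero]
      rw [Finset.sum_ite_eq' , if_pos (Finset.mem_range.mpr (by omega))]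
    · simp [hj]
  have := coeff_eq_zero_of_eq_pow_sub (not_dvd_prime_pow_add_one hp0 hp2 i) hg (fun j hj => by
    rw [hcoeff, if_neg (by omega)])
  have h0 := hcoeff 0
  rwa [pow_zero, mul_one, this, if_pos rfl, eq_comm] at h0

/-- Once the terms of exponent `p^i + 1` are gone, evaluation at 0 gives the equation for `b =
g(0)`, and `g - g(0)` with `X` replaced by `a⁻¹ X` is `B_c`. -/
theorem exists_isB_of_eq_pow_sub [CharP k p] (hp2 : p ≠ 2) {a c d : k} (ha : a ≠ 0) {g : k[X]}
    (hg : (X * R.poly).comp (C a * X + C c) - C d * (X * R.poly) = g ^ p - g) :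
    (g.coeff 0) ^ p - g.coeff 0 = c * R.poly.eval c ∧
      ∃ B, R.IsB c B ∧ g = B.comp (C a * X) + C (g.coeff 0) := by
  have hz : ∑ i ∈ Finset.range (R.h + 1), C (R.a i * (a ^ (p ^ i + 1) - d)) * X ^ (p ^ i + 1)
      = 0 := Finset.sum_eq_zero fun i hi => by
    rw [R.pow_eq_of_eq_pow_sub hp2 hg (Finset.mem_range_succ_iff.mp hi), C_0, zero_mul]
  rw [X_mul_poly_comp_sub, hz, zero_add] at hg
  have hb : (g.coeff 0) ^ p - g.coeff 0 = c * R.poly.eval c := by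
    have := congrArg (eval 0) hg
    simp only [eval_add, eval_mul, eval_C, eval_comp, eval_X, mul_zero, R.eval_poly_zero,
      zero_add, eval_sub, eval_pow] at this
    rw [coeff_zero_eq_eval_zero, this]
  refine ⟨hb, (g - C (g.coeff 0)).comp (C a⁻¹ * X), ⟨?_, ?_⟩, ?_⟩
  · rw [X_dvd_iff, coeff_zero_eq_eval_zero]
    simp [eval_comp, coeff_zero_eq_eval_zero]
  · have h1 : (C a * X : k[X]).comp (C a⁻¹ * X) = X := by
      simp [← mul_assoc, ← C_mul, ha]
    have h2 := congrArg (fun q : k[X] => q.comp (C a⁻¹ * X)) hg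
    simp only [add_comp, mul_comp (C c), mul_comp (C (eval c R.poly)), C_comp, comp_assoc, h1,
      comp_X, sub_comp, pow_comp] at h2
    rw [sub_comp, C_comp, sub_pow_char, ← C_pow]
    have h3 := congrArg C hb
    rw [C_sub] at h3
    linear_combination -h2 - h3
  · have h1 : (C a⁻¹ * X : k[X]).comp (C a * X) = X := by
      simp [← mul_assoc, ← C_mul, ha]
    rw [comp_assoc, h1, comp_X]
    ring

theorem IsB.unique [CharP k p] {c : k} {B B' : k[X]} (h : R.IsB c B) (h' : R.IsB c B') :
    B = B' := by
  have h1 : (B - B') ^ p = B - B' := by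
    rw [sub_pow_char]
    linear_combination h.2 - h'.2
  have h2 : X ∣ B - B' := dvd_sub h.1 h'.1
  by_contra hne
  have hne' : B - B' ≠ 0 := sub_ne_zero.mpr hne
  have h3 := congrArg natDegree h1
  rw [natDegree_pow] at h3
  have h4 := hp.out.one_lt
  have h5 : (B - B').natDegree = 0 := by nlinarith
  rw [eq_C_of_natDegree_eq_zero h5, X_dvd_iff, coeff_C_zero] at h2
  rw [eq_C_of_natDegree_eq_zero h5, h2, C_0] at hne'
  exact hne' rfl

theorem isB_zero : R.IsB 0 0 := by
  refine ⟨dvd_zero _, ?_⟩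
  simp [R.eval_poly_zero, hp.out.ne_zero]

theorem eq_pow_sub_of_isB [CharP k p] {a b c d : k}
    (h : ∀ i ≤ R.h, R.a i ≠ 0 → a ^ (p ^ i + 1) = d) (hb : b ^ p - b = c * R.poly.eval c)
    {B : k[X]} (hB : R.IsB c B) :
    (X * R.poly).comp (C a * X + C c) - C d * (X * R.poly)
      = (B.comp (C a * X) + C b) ^ p - (B.comp (C a * X) + C b) := by
  rw [X_mul_poly_comp_sub, Finset.sum_eq_zero, zero_add, ← hb, add_pow_char, C_sub, C_pow]
  · have := congrArg (fun q : k[X] => q.comp (C a * X)) hB.2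
    simp only [sub_comp, pow_comp, add_comp, mul_comp, C_comp, X_comp] at this
    linear_combination -this
  · intro i hi
    by_cases h0 : R.a i = 0
    · simp [h0]
    · simp [h i (Finset.mem_range_succ_iff.mp hi) h0]

theorem eval_poly_pow [CharP k p] (c : k) (n : ℕ) :
    R.poly.eval c ^ p ^ n = ∑ i ∈ Finset.range (R.h + 1), R.a i ^ p ^ n * c ^ p ^ (n + i) := by
  rw [eval_poly, sum_pow_char_pow]
  refine Finset.sum_congr rfl fun i _ => ?_
  rw [mul_pow, ← pow_mul, ← pow_add, add_comm n i]

/-- The polynomial whose roots are the elements of `W`. -/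
noncomputable def kernelPoly : k[X] :=
  ∑ i ∈ Finset.range (R.h + 1), C (R.a i ^ p ^ (R.h - i)) * X ^ p ^ (R.h - i)
    + ∑ i ∈ Finset.range (R.h + 1), C (R.a i ^ p ^ R.h) * X ^ p ^ (R.h + i)

/-- `c R(X) + R(c) X` is additive with coefficients `c a_i`, to which `R(c)` is added at `i = 0`.
`kernelPoly` at `c` is the obstruction of `exists_pow_sub_eq_iff` for these coefficients. -/
theorem mem_W_iff [CharP k p] [IsAlgClosed k] (c : k) :
    c ∈ R.W ↔ R.kernelPoly.eval c = 0 := by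
  have h := exists_pow_sub_eq_iff (p := p)
    (fun i => c * R.a i + if i = 0 then R.poly.eval c else 0) R.h
  have h1 : ∑ i ∈ Finset.range (R.h + 1),
      C (c * R.a i + if i = 0 then R.poly.eval c else 0) * X ^ p ^ i
      = C c * R.poly + C (R.poly.eval c) * X := by
    simp only [C_add, add_mul, Finset.sum_add_distrib]
    congr 1
    · rw [poly, Finset.mul_sum]
      refine Finset.sum_congr rfl fun i _ => ?_
      rw [C_mul, mul_assoc]
    · rw [Finset.sum_eq_single 0]
      · simp
      · intro i _ hi
        simp [hi]
      · simp
  have h2 : ∑ i ∈ Finset.range (R.h + 1),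
      (c * R.a i + if i = 0 then R.poly.eval c else 0) ^ p ^ (R.h - i) = R.kernelPoly.eval c := by
    simp only [add_pow_char_pow, Finset.sum_add_distrib, kernelPoly, eval_add, eval_finsetSum]
    congr 1
    · refine Finset.sum_congr rfl fun i _ => ?_
      simp only [eval_mul, eval_C, eval_pow, eval_X]
      ring
    · rw [Finset.sum_eq_single 0]
      · simp [eval_poly_pow]
      · intro i _ hi
        simp [hi, hp.out.ne_zero]
      · simp
  rw [h1, h2] at h
  exact h

theorem natDegree_kernelPoly [CharP k p] (hp2 : p ≠ 2) :
    R.kernelPoly.natDegree = p ^ (2 * R.h) := by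
  have hp0 := hp.out
  refine natDegree_eq_of_le_of_coeff_ne_zero ?_ ?_
  · refine (natDegree_add_le _ _).trans (max_le ?_ ?_)
    all_goals
      refine natDegree_sum_le_of_forall_le _ _ fun i hi => (natDegree_C_mul_X_pow_le _ _).trans ?_
      have := Finset.mem_range.mp hi
      exact Nat.pow_le_pow_right hp0.pos (by omega)
  · have hinj : ∀ m n, p ^ m = p ^ n ↔ m = n := fun m n =>
      (Nat.pow_right_injective hp0.two_le).eq_iff
    simp only [kernelPoly, coeff_add, finsetSum_coeff, coeff_C_mul, coeff_X_pow, hinj]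
    rw [Finset.sum_eq_single_of_mem (a := R.h) (h := by simp)
      (f := fun i => R.a i ^ p ^ R.h * if 2 * R.h = R.h + i then 1 else 0)]
    -- For `h = 0` both sums contribute and the leading coefficient is `2 a_0`, nonzero because `p`
    -- is odd. For `h > 0` only the second sum reaches degree `p^(2h)`.
    · by_cases hh : R.h = 0
      · have := R.a_ne_zero
        rw [hh] at this
        have h2 : (2 : k) ≠ 0 := two_ne_zero_of_charP hp2
        simp only [hh, zero_add, Finset.sum_range_one, mul_zero, Nat.sub_self, pow_zero, pow_one,
          if_true, mul_one, add_zero]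
        rw [← two_mul]
        exact mul_ne_zero h2 this
      · rw [Finset.sum_eq_zero, zero_add, if_pos (by omega), mul_one]
        · exact pow_ne_zero _ R.a_ne_zero
        · intro i hi
          rw [if_neg (by omega), mul_zero]
    · intro i hi hne
      rw [if_neg (by omega), mul_zero]

/-- All exponents are powers of `p`, so the derivative is the coefficient of `X`: this is `a_h`, or
`2 a_0` when `h = 0`. -/
theorem separable_kernelPoly [CharP k p] (hp2 : p ≠ 2) : R.kernelPoly.Separable := by
  have hp0 := hp.out
  obtain ⟨u, hu, hd⟩ : ∃ u : k, u ≠ 0 ∧ derivative R.kernelPoly = C u := by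
    have hder : ∀ (r : k) (m : ℕ), derivative (C r * X ^ p ^ m) = if m = 0 then C r else 0 := by
      intro r m
      by_cases hm : m = 0
      · simp [hm]
      · have : ((p ^ m : ℕ) : k) = 0 := by
          rw [Nat.cast_pow, CharP.cast_eq_zero, zero_pow hm]
        rw [derivative_C_mul_X_pow, this, mul_zero, C_0, zero_mul, if_neg hm]
    simp only [kernelPoly, derivative_add, derivative_sum, hder]
    rw [Finset.sum_eq_single_of_mem (a := R.h) (h := by simp)
      (f := fun i => if R.h - i = 0 then C (R.a i ^ p ^ (R.h - i)) else 0)]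
    · by_cases hh : R.h = 0
      · have := R.a_ne_zero
        rw [hh] at this
        have h2 : (2 : k) ≠ 0 := two_ne_zero_of_charP hp2
        refine ⟨2 * R.a 0, mul_ne_zero h2 this, ?_⟩
        simp only [hh, zero_add, Finset.sum_range_one, Nat.sub_self, pow_zero, pow_one, if_true]
        rw [two_mul, C_add]
      · refine ⟨R.a R.h, R.a_ne_zero, ?_⟩
        rw [Finset.sum_eq_zero, add_zero]
        · simp
        · intro i hi
          rw [if_neg (by omega)]
    · intro i hi hne
      have := Finset.mem_range.mp hi
      rw [if_neg (by omega)]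
  rw [separable_def, hd]
  exact ⟨0, C u⁻¹, by rw [zero_mul, zero_add, ← C_mul, inv_mul_cancel₀ hu, C_1]⟩

theorem card_W [CharP k p] [IsAlgClosed k] (hp2 : p ≠ 2) : Nat.card R.W = p ^ (2 * R.h) := by
  have h := card_rootSet_eq_natDegree (K := k) (R.separable_kernelPoly hp2) (IsAlgClosed.splits _)
  rw [R.natDegree_kernelPoly hp2, ← Nat.card_eq_fintype_card] at h
  refine (Nat.card_congr (Equiv.subtypeEquivRight fun b => ?_)).trans h
  rw [mem_rootSet_of_ne (R.separable_kernelPoly hp2).ne_zero, mem_W_iff]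
  simp

theorem card_translations [CharP k p] [IsAlgClosed k] (hp2 : p ≠ 2) :
    Nat.card {t : k × k // t.1 ^ p - t.1 = t.2 * R.poly.eval t.2 ∧ t.2 ∈ R.W}
      = p ^ (2 * R.h + 1) := by
  have hfin : Finite R.W := Nat.finite_of_card_ne_zero (by
    rw [R.card_W hp2]
    exact pow_ne_zero _ hp.out.ne_zero)
  have : Fintype R.W := Fintype.ofFinite _
  have e : {t : k × k // t.1 ^ p - t.1 = t.2 * R.poly.eval t.2 ∧ t.2 ∈ R.W} ≃
      Σ c : R.W, {b : k // b ^ p - b = c * R.poly.eval (c : k)} :=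
    { toFun := fun t => ⟨⟨t.1.2, t.2.2⟩, ⟨t.1.1, t.2.1⟩⟩
      invFun := fun s => ⟨(s.2.1, s.1.1), s.2.2, s.1.2⟩
      left_inv := fun _ => rfl
      right_inv := fun _ => rfl }
  have hf : ∀ c : R.W, Finite {b : k // b ^ p - b = c * R.poly.eval (c : k)} := fun c =>
    Nat.finite_of_card_ne_zero (by rw [card_pow_sub_eq]; exact hp.out.ne_zero)
  rw [Nat.card_congr e, Nat.card_sigma]
  simp only [card_pow_sub_eq, Finset.sum_const, Finset.card_univ, smul_eq_mul]
  rw [← Nat.card_eq_fintype_card, R.card_W hp2, pow_succ]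

end AdditivePoly

end ASCurve

/-! ### The group of pairs `(a, d)` and its order -/

namespace ASCurve

/-- For `p = 2m + 1` and `n` odd, `M = (p^n - 1)/(p - 1)` is a sum of `n` odd numbers. -/
theorem exists_odd_pow_eq (m t : ℕ) :
    ∃ M, Odd M ∧ (2 * m + 1) ^ (2 * t + 1) = 2 * m * M + 1 := by
  induction t with
  | zero => exact ⟨1, odd_one, by simp⟩
  | succ t ih =>
    obtain ⟨M, hM, h⟩ := ih
    refine ⟨M * (2 * m + 1) ^ 2 + 2 * (m + 1), ?_, ?_⟩
    · exact (hM.mul (odd_two_mul_add_one m).pow).add_even (even_two_mul _)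
    · rw [show 2 * (t + 1) + 1 = (2 * t + 1) + 2 by ring, pow_add, h]
      ring

/-- The conclusion is Euler's criterion for `d` to be a square. With `M = (p^n - 1)/(p - 1)` odd,
`d^((p-1)/2) = d^(M(p-1)/2)`, which is a power of `a^(p^n - 1) = 1` because `p^j + 1` is even. -/
theorem pow_eq_one_of_pow_prime_pow_eq {p : ℕ} (hp : Odd p) {G : Type*} [Group G] {a d : G}
    {j n : ℕ} (hn : Odd n) (ha : a ^ p ^ n = a) (hd : a ^ (p ^ j + 1) = d)
    (hd1 : d ^ (p - 1) = 1) : d ^ (p / 2) = 1 := by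
  obtain ⟨m, rfl⟩ := hp
  obtain ⟨t, rfl⟩ := hn
  obtain ⟨M, ⟨r, hr⟩, hM⟩ := exists_odd_pow_eq m t
  obtain ⟨s, hs⟩ : Even ((2 * m + 1) ^ j + 1) := (odd_two_mul_add_one m).pow.add_one
  have h1 : a ^ (2 * m * M) = 1 := by
    rw [hM, pow_succ] at ha
    simpa using ha
  have h2 : (2 * m + 1) / 2 = m := by omega
  have h3 : d ^ (2 * m) = 1 := by simpa using hd1
  rw [h2]
  calc d ^ m = d ^ (2 * m * r + m) := by rw [pow_add, pow_mul, h3, one_pow, one_mul]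
    _ = d ^ (m * M) := by rw [hr]; ring_nf
    _ = a ^ (2 * m * M * s) := by rw [← hd, ← pow_mul, hs]; ring_nf
    _ = 1 := by rw [pow_mul, h1, one_pow]

theorem pow_pow_two_mul_eq {G : Type*} [Monoid G] {p : ℕ} {a : G} (ha : a ^ p ^ 2 = a) (t : ℕ) :
    a ^ p ^ (2 * t) = a := by
  induction t with
  | zero => simp
  | succ t ih => rw [mul_add, pow_add, pow_mul, ih, mul_one, ha]

namespace AdditivePoly

variable {p : ℕ} {k : Type*} [Field k] (R : AdditivePoly p k) [hp : Fact p.Prime]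
  [Algebra (ZMod p) k]

/-- The pairs `(a, d)` with `(a, 0, d) ∈ S(X R(X))`. -/
def torus : Subgroup (kˣ × (ZMod p)ˣ) where
  carrier := {t | ∀ i ≤ R.h, R.a i ≠ 0 →
    t.1 ^ (p ^ i + 1) = Units.map (algebraMap (ZMod p) k).toMonoidHom t.2}
  one_mem' := fun i _ _ => by simp
  mul_mem' := fun {s t} hs ht i hi h => by
    rw [Prod.fst_mul, Prod.snd_mul, mul_pow, hs i hi h, ht i hi h, map_mul]
  inv_mem' := fun {s} hs i hi h => by
    rw [Prod.fst_inv, Prod.snd_inv, inv_pow, hs i hi h, map_inv]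

theorem units_map_algebraMap_injective :
    Function.Injective (Units.map (algebraMap (ZMod p) k).toMonoidHom) :=
  Units.map_injective (algebraMap (ZMod p) k).injective

theorem eq_of_mem_torus {s t : kˣ × (ZMod p)ˣ} (hs : s ∈ R.torus) (ht : t ∈ R.torus)
    (h : s.1 = t.1) : s = t := by
  refine Prod.ext h (units_map_algebraMap_injective (k := k) ?_)
  rw [← hs R.h le_rfl R.a_ne_zero, ← ht R.h le_rfl R.a_ne_zero, h]

omit hp [Algebra (ZMod p) k] in
theorem pow_gcdExp_eq_one_iff (a : kˣ) :
    a ^ R.gcdExp = 1 ↔ ∀ i ≤ R.h, R.a i ≠ 0 → a ^ (p ^ i + 1) = 1 := by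
  classical
  simp only [← orderOf_dvd_iff_pow_eq_one, gcdExp, Finset.dvd_gcd_iff, Finset.mem_filter,
    Finset.mem_range_succ_iff, and_imp]

omit hp [Algebra (ZMod p) k] in
theorem gcdExp_dvd : R.gcdExp ∣ p ^ R.h + 1 := by
  classical
  exact Finset.gcd_dvd (Finset.mem_filter.mpr ⟨Finset.self_mem_range_succ _, R.a_ne_zero⟩)

omit [Algebra (ZMod p) k] in
theorem not_dvd_gcdExp (hp2 : p ≠ 2) : ¬ p ∣ R.gcdExp := fun h =>
  not_dvd_prime_pow_add_one hp.out hp2 R.h (h.trans R.gcdExp_dvd)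

/-- The projection of the torus to its second coordinate. -/
def torusSnd : R.torus →* (ZMod p)ˣ := (MonoidHom.snd kˣ (ZMod p)ˣ).comp R.torus.subtype

/-- The kernel consists of the roots of unity of order dividing `gcdExp`. There are `gcdExp` of them
since `p` does not divide this number. -/
theorem card_ker_torusSnd [IsAlgClosed k] (hp2 : p ≠ 2) :
    Nat.card R.torusSnd.ker = R.gcdExp := by
  have : CharP k p := charP_of_injective_algebraMap (algebraMap (ZMod p) k).injective p
  have hne : NeZero (R.gcdExp : k) := ⟨fun h =>
    R.not_dvd_gcdExp hp2 ((CharP.cast_eq_zero_iff k p _).mp h)⟩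
  have hne' : NeZero R.gcdExp := ⟨fun h => by
    have := R.gcdExp_dvd
    rw [h, zero_dvd_iff] at this
    omega⟩
  rw [← HasEnoughRootsOfUnity.natCard_rootsOfUnity k R.gcdExp]
  refine Nat.card_congr
    { toFun := fun t => ⟨t.1.1.1, ?_⟩
      invFun := fun a => ⟨⟨(a.1, 1), ?_⟩, ?_⟩
      left_inv := ?_
      right_inv := ?_ }
  · obtain ⟨⟨t, ht⟩, h1⟩ := t
    have h2 : t.2 = 1 := h1
    rw [mem_rootsOfUnity, pow_gcdExp_eq_one_iff]
    intro i hi h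
    rw [ht i hi h, h2, map_one]
  · intro i hi h
    rw [map_one]
    exact (R.pow_gcdExp_eq_one_iff _).mp ((mem_rootsOfUnity _ _).mp a.2) i hi h
  · rfl
  · rintro ⟨⟨t, ht⟩, h1⟩
    have h2 : t.2 = 1 := h1
    exact Subtype.ext (Subtype.ext (Prod.ext rfl h2.symm))
  · intro a
    rfl

/-- A square root `a` of `d` satisfies `a^(p^2) = a`, so `a^(p^i + 1) = a^2` for even `i`. -/
theorem mem_range_torusSnd_of_forall_even [IsAlgClosed k]
    (h : ∀ i ≤ R.h, R.a i ≠ 0 → Even i) (d : (ZMod p)ˣ) (hp2 : p ≠ 2) :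
    d ∈ R.torusSnd.range := by
  set D : kˣ := Units.map (algebraMap (ZMod p) k).toMonoidHom d with hD
  have hD1 : D ^ (p - 1) = 1 := by rw [hD, ← map_pow, ZMod.units_pow_card_sub_one_eq_one, map_one]
  obtain ⟨a, ha⟩ := IsAlgClosed.exists_pow_nat_eq (D : k) two_pos
  have ha0 : a ≠ 0 := by
    rintro rfl
    exact D.ne_zero (by rw [← ha]; simp)
  set u := Units.mk0 a ha0 with hu
  have hu2 : u ^ 2 = D := Units.ext (by simpa [hu] using ha)
  obtain ⟨m, hm⟩ := hp.out.odd_of_ne_two hp2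
  have hp : u ^ p ^ 2 = u := by
    have h1 : p ^ 2 = 2 * ((p - 1) * (m + 1)) + 1 := by
      rw [hm, Nat.add_sub_cancel]
      ring
    rw [h1, pow_succ, pow_mul, hu2, pow_mul, hD1, one_pow, one_mul]
  refine ⟨⟨(u, d), fun i hi hai => ?_⟩, rfl⟩
  obtain ⟨t, rfl⟩ := (h i hi hai).two_dvd
  rw [pow_succ, pow_pow_two_mul_eq hp, ← sq, hu2]

/-- A `(p+1)`-st root `a` of `d` satisfies `a^(p^2) = a`, so `a^(p^i + 1) = a^(p+1)` for odd `i`. -/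
theorem mem_range_torusSnd_of_forall_odd [IsAlgClosed k]
    (h : ∀ i ≤ R.h, R.a i ≠ 0 → ¬ Even i) (d : (ZMod p)ˣ) :
    d ∈ R.torusSnd.range := by
  set D : kˣ := Units.map (algebraMap (ZMod p) k).toMonoidHom d with hD
  have hD1 : D ^ (p - 1) = 1 := by rw [hD, ← map_pow, ZMod.units_pow_card_sub_one_eq_one, map_one]
  obtain ⟨a, ha⟩ := IsAlgClosed.exists_pow_nat_eq (D : k) (Nat.succ_pos p)
  have ha0 : a ≠ 0 := by
    rintro rfl
    exact D.ne_zero (by rw [← ha]; simp)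
  set u := Units.mk0 a ha0 with hu
  have hu2 : u ^ (p + 1) = D := Units.ext (by simpa [hu] using ha)
  have hp : u ^ p ^ 2 = u := by
    have h1 : p ^ 2 = (p + 1) * (p - 1) + 1 := by
      obtain ⟨m, hm⟩ := Nat.exists_eq_succ_of_ne_zero hp.out.ne_zero
      rw [hm]
      simp only [Nat.succ_eq_add_one, Nat.add_sub_cancel]
      ring
    rw [h1, pow_succ, pow_mul, hu2, hD1, one_mul]
  refine ⟨⟨(u, d), fun i hi hai => ?_⟩, rfl⟩
  obtain ⟨t, rfl⟩ := Nat.not_even_iff_odd.mp (h i hi hai)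
  rw [pow_succ, pow_succ, pow_mul, pow_pow_two_mul_eq hp, ← pow_succ, hu2]

theorem mem_range_torusSnd_of_isSquare (s : (ZMod p)ˣ) : s ^ 2 ∈ R.torusSnd.range := by
  refine ⟨⟨(Units.map (algebraMap (ZMod p) k).toMonoidHom s, s ^ 2), fun i _ _ => ?_⟩, rfl⟩
  have : s ^ p ^ i = s := Units.ext (by rw [Units.val_pow_eq_pow_val, ZMod.pow_card_pow])
  rw [← map_pow, pow_succ, this, sq]

/-- Equating the two conditions on `a` gives `a^(p^i) = a^(p^j)`. Injectivity of Frobenius then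
yields `a^(p^(i-j)) = a` with `i - j` odd. -/
theorem pow_half_eq_one_of_mem_range_torusSnd (hp2 : p ≠ 2)
    {i j : ℕ} (hi : i ≤ R.h) (hj : j ≤ R.h) (hai : R.a i ≠ 0) (haj : R.a j ≠ 0)
    (hij : ¬ (Even i ↔ Even j)) {d : (ZMod p)ˣ} (hd : d ∈ R.torusSnd.range) :
    d ^ (p / 2) = 1 := by
  have : CharP k p := charP_of_injective_algebraMap (algebraMap (ZMod p) k).injective p
  wlog hlt : j < i generalizing i j
  · refine this hj hi haj hai (fun h => hij h.symm) ?_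
    have : i ≠ j := by
      rintro rfl
      exact hij Iff.rfl
    omega
  obtain ⟨⟨t, ht⟩, rfl⟩ := hd
  change t.2 ^ (p / 2) = 1
  obtain ⟨n, rfl⟩ := Nat.exists_eq_add_of_lt hlt
  have h1 := ht _ hi hai
  have h2 := ht _ hj haj
  have h3 : t.1 ^ p ^ (n + 1) = t.1 := by
    rw [← h2] at h1
    have h4 := congrArg Units.val
      (mul_right_cancel (((pow_succ _ _).symm.trans h1).trans (pow_succ _ _)))
    simp only [Units.val_pow_eq_pow_val] at h4
    refine Units.ext (iterateFrobenius_inj k p j ?_)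
    simp only [iterateFrobenius_def, Units.val_pow_eq_pow_val]
    rw [← pow_mul, ← pow_add, ← h4]
    congr 2
    ring
  refine units_map_algebraMap_injective (k := k) ?_
  rw [map_pow, map_one]
  refine pow_eq_one_of_pow_prime_pow_eq (hp.out.odd_of_ne_two hp2) (n := n + 1) ?_ h3 h2 ?_
  · rw [← Nat.not_even_iff_odd]
    intro he
    refine hij ?_
    rw [add_assoc, Nat.even_add]
    simp [he]
  · rw [← map_pow, ZMod.units_pow_card_sub_one_eq_one, map_one]

theorem card_range_torusSnd [IsAlgClosed k] (hp2 : p ≠ 2) :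
    Nat.card R.torusSnd.range = R.e * (p - 1) / 2 := by
  have hp1 := hp.out.two_le
  have hcard : Nat.card (ZMod p)ˣ = p - 1 := by
    rw [Nat.card_eq_fintype_card, ZMod.card_units]
  rw [e]
  split_ifs with h
  · have : R.torusSnd.range = ⊤ := by
      rw [eq_top_iff]
      intro d _
      by_cases hh : Even R.h
      · exact R.mem_range_torusSnd_of_forall_even
          (fun i hi hai => (h i hi R.h le_rfl hai R.a_ne_zero).mpr hh) d hp2
      · exact R.mem_range_torusSnd_of_forall_odd
          (fun i hi hai he => hh ((h i hi R.h le_rfl hai R.a_ne_zero).mp he)) d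
    rw [this, Subgroup.card_top, hcard]
    omega
  · push Not at h
    obtain ⟨i, hi, j, hj, hai, haj, hij⟩ := h
    have : R.torusSnd.range = (powMonoidHom 2 : (ZMod p)ˣ →* (ZMod p)ˣ).range := by
      ext d
      constructor
      · intro hd
        obtain ⟨y, hy⟩ := (ZMod.euler_criterion_units p d).mpr
          (R.pow_half_eq_one_of_mem_range_torusSnd hp2 hi hj hai haj (by tauto) hd)
        exact ⟨y, hy⟩
      · rintro ⟨y, rfl⟩
        exact R.mem_range_torusSnd_of_isSquare y
    rw [this, IsCyclic.card_powMonoidHom_range, hcard, one_mul]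
    obtain ⟨m, hm⟩ := hp.out.odd_of_ne_two hp2
    rw [Nat.gcd_eq_right ⟨m, by omega⟩]

theorem card_torus [IsAlgClosed k] (hp2 : p ≠ 2) :
    Nat.card R.torus = R.e * (p - 1) / 2 * R.gcdExp := by
  rw [← R.torusSnd.ker.card_mul_index, Subgroup.index_ker, R.card_ker_torusSnd hp2,
    R.card_range_torusSnd hp2, mul_comm]

theorem not_dvd_card_torus [IsAlgClosed k] (hp2 : p ≠ 2) : ¬ p ∣ Nat.card R.torus := by
  have hp1 := hp.out.two_le
  have h1 : ¬ p ∣ Nat.card R.torusSnd.range := by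
    intro h
    have h2 := h.trans (Subgroup.card_subgroup_dvd_card R.torusSnd.range)
    rw [Nat.card_eq_fintype_card, ZMod.card_units] at h2
    have := Nat.le_of_dvd (by omega) h2
    omega
  rw [← R.torusSnd.ker.card_mul_index, Subgroup.index_ker, R.card_ker_torusSnd hp2]
  exact hp.out.not_dvd_mul (R.not_dvd_gcdExp hp2) h1

end AdditivePoly

end ASCurve

namespace ASCurve

/-! ### Values of rational functions -/

namespace Point

variable {k K : Type*} [Field k] [Field K] [Algebra k K] {P : Point k K}

theorem ext' {P P' : Point k K} (h : ∀ z, z ∈ P.localRing ↔ z ∈ P'.localRing) : P = P' := by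
  obtain ⟨O, _, _⟩ := P
  obtain ⟨O', _, _⟩ := P'
  have : O = O' := SetLike.ext h
  subst this
  rfl

theorem hasValue_iff {f : K} {v : k} :
    P.HasValue f v ↔ P.localRing.valuation (f - algebraMap k K v) < 1 :=
  ValuationSubring.mem_nonunits_iff _

theorem valuation_algebraMap {c : k} (hc : c ≠ 0) :
    P.localRing.valuation (algebraMap k K c) = 1 := by
  refine le_antisymm ((P.localRing.valuation_le_one_iff _).mpr (P.algebraMap_mem c)) ?_
  have h := (P.localRing.valuation_le_one_iff _).mpr (P.algebraMap_mem c⁻¹)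
  rw [map_inv₀, map_inv₀] at h
  have h0 : P.localRing.valuation (algebraMap k K c) ≠ 0 := by simpa using hc
  exact (inv_le_one₀ (zero_lt_iff.mpr h0)).mp h

theorem valuation_algebraMap_le (c : k) : P.localRing.valuation (algebraMap k K c) ≤ 1 :=
  (P.localRing.valuation_le_one_iff _).mpr (P.algebraMap_mem c)

theorem HasValue.mem {f : K} {v : k} (h : P.HasValue f v) : f ∈ P.localRing := by
  have h1 := P.localRing.nonunits_subset h
  have h2 := add_mem h1 (P.algebraMap_mem v)
  rwa [sub_add_cancel] at h2

theorem HasValue.unique {f : K} {v w : k} (h : P.HasValue f v) (h' : P.HasValue f w) : v = w := by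
  by_contra hne
  rw [hasValue_iff] at h h'
  have h1 := Valuation.map_sub_lt _ h h'
  rw [sub_sub_sub_cancel_left, ← map_sub,
    valuation_algebraMap (sub_ne_zero.mpr (Ne.symm hne))] at h1
  exact lt_irrefl _ h1

end Point

namespace AdditivePoly

/-! ### The affine coordinate ring -/

section CoordinateRing

variable {p : ℕ} {k : Type*} [Field k] (R : AdditivePoly p k)

/-- The coordinate function `x` on the affine curve. -/
noncomputable def coordX : R.CoordinateRing := AdjoinRoot.of R.equation X

/-- The coordinate function `y` on the affine curve. -/
noncomputable def coordY : R.CoordinateRing := AdjoinRoot.root R.equation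

theorem of_eq_aeval (N : k[X]) : AdjoinRoot.of R.equation N = aeval R.coordX N := by
  have h : (AdjoinRoot.ofAlgHom k R.equation) = aeval R.coordX := by
    ext
    simp [coordX]
  exact DFunLike.congr_fun h N

theorem coordY_pow_sub : R.coordY ^ p - R.coordY = R.coordX * aeval R.coordX R.poly := by
  have h := AdjoinRoot.mk_self (f := R.equation)
  have h1 : AdjoinRoot.mk R.equation (X ^ p - X - C (X * R.poly)) = 0 := h
  rw [map_sub, map_sub, map_pow, AdjoinRoot.mk_X, AdjoinRoot.mk_C] at h1
  rw [← R.of_eq_aeval, coordX, ← map_mul]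
  exact sub_eq_zero.mp h1

theorem adjoin_coord : Algebra.adjoin k {R.coordX, R.coordY} = ⊤ := by
  rw [eq_top_iff]
  rintro z -
  obtain ⟨F, rfl⟩ := AdjoinRoot.mk_surjective z
  have hx : R.coordX ∈ Algebra.adjoin k {R.coordX, R.coordY} :=
    Algebra.subset_adjoin (Set.mem_insert _ _)
  have hy : R.coordY ∈ Algebra.adjoin k {R.coordX, R.coordY} :=
    Algebra.subset_adjoin (Set.mem_insert_of_mem _ rfl)
  have hof : ∀ N : k[X], AdjoinRoot.of R.equation N ∈ Algebra.adjoin k {R.coordX, R.coordY} := by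
    intro N
    rw [of_eq_aeval]
    exact Algebra.adjoin_mono (Set.singleton_subset_iff.mpr (Set.mem_insert _ _))
      (aeval_mem_adjoin_singleton k R.coordX)
  induction F using Polynomial.induction_on' with
  | add F G hF hG =>
    rw [map_add]
    exact add_mem hF hG
  | monomial n N =>
    rw [← C_mul_X_pow_eq_monomial, map_mul, map_pow]
    exact mul_mem (hof N) (pow_mem hy n)

variable {R} in
theorem algHom_ext {T : Type*} [Semiring T] [Algebra k T] {f g : R.CoordinateRing →ₐ[k] T}
    (hx : f R.coordX = g R.coordX) (hy : f R.coordY = g R.coordY) : f = g := by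
  refine AlgHom.ext_of_adjoin_eq_top R.adjoin_coord ?_
  rintro z (rfl | rfl)
  exacts [hx, hy]

/-- The homomorphism with given values of the coordinate functions. -/
noncomputable def lift {T : Type*} [CommRing T] [Algebra k T] (u v : T)
    (h : v ^ p - v = u * aeval u R.poly) : R.CoordinateRing →ₐ[k] T :=
  AdjoinRoot.liftAlgHom R.equation (aeval u) v (by
    simp [equation, eval₂_sub, eval₂_pow, eval₂_X, eval₂_C, h])

theorem lift_coordX {T : Type*} [CommRing T] [Algebra k T] {u v : T}
    (h : v ^ p - v = u * aeval u R.poly) : R.lift u v h R.coordX = u := by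
  simp [lift, coordX]

theorem lift_coordY {T : Type*} [CommRing T] [Algebra k T] {u v : T}
    (h : v ^ p - v = u * aeval u R.poly) : R.lift u v h R.coordY = v := by
  simp [lift, coordY]

theorem algHom_aeval {T : Type*} [CommRing T] [Algebra k T] (f : R.CoordinateRing →ₐ[k] T)
    (N : k[X]) : f (aeval R.coordX N) = aeval (f R.coordX) N := (aeval_algHom_apply f _ _).symm

end CoordinateRing

section Monic

variable {p : ℕ} [hp : Fact p.Prime] {k : Type*} [Field k] (R : AdditivePoly p k)

omit hp in
theorem equation_eq : R.equation = X ^ p + -(X + C (X * R.poly)) := by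
  rw [equation]
  ring

theorem degree_neg_X_add_C_lt (q : k[X]) : (-(X + C q) : k[X][X]).degree < (p : ℕ) := by
  rw [degree_neg, degree_X_add_C]
  exact_mod_cast hp.out.one_lt

theorem monic_equation : R.equation.Monic := by
  rw [equation_eq]
  exact monic_X_pow_add (degree_neg_X_add_C_lt _)

theorem natDegree_equation : R.equation.natDegree = p := by
  rw [equation_eq, natDegree_add_eq_left_of_degree_lt, natDegree_X_pow]
  rw [degree_X_pow]
  exact degree_neg_X_add_C_lt _

theorem of_injective : Function.Injective (AdjoinRoot.of R.equation) := by
  refine AdjoinRoot.of.injective_of_degree_ne_zero ?_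
  rw [degree_eq_natDegree R.monic_equation.ne_zero, natDegree_equation]
  exact_mod_cast hp.out.ne_zero

theorem coordX_sub_ne_zero (u : k) : R.coordX - algebraMap k _ u ≠ 0 := by
  intro h
  refine X_sub_C_ne_zero u (R.of_injective ?_)
  rw [of_eq_aeval, map_zero, map_sub, aeval_X, aeval_C, h]

end Monic

/-! ### Affine points as `k`-homomorphisms from the coordinate ring to `k` -/

section AffinePoints

variable {p : ℕ} [hp : Fact p.Prime] {k : Type*} [Field k] [Algebra (ZMod p) k]
  (R : AdditivePoly p k)

theorem charP : CharP k p :=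
  charP_of_injective_algebraMap (algebraMap (ZMod p) k).injective p

theorem exists_dvd_aeval {f : R.CoordinateRing} (hf : f ≠ 0) :
    ∃ N : k[X], N ≠ 0 ∧ f ∣ aeval R.coordX N := by
  have hfin : Module.Finite k[X] R.CoordinateRing := R.monic_equation.finite_adjoinRoot
  have h := Ideal.comap_ne_bot_of_integral_mem (R := k[X]) hf (Ideal.mem_span_singleton_self f)
    (Algebra.IsIntegral.isIntegral f)
  obtain ⟨N, hN, hN0⟩ := Submodule.exists_mem_ne_zero_of_ne_bot h
  refine ⟨N, hN0, ?_⟩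
  rw [← R.of_eq_aeval]
  exact Ideal.mem_span_singleton.mp hN

variable {R}

omit hp [Algebra (ZMod p) k] in
theorem hom_pow_sub (ε : R.CoordinateRing →ₐ[k] k) :
    ε R.coordY ^ p - ε R.coordY = ε R.coordX * R.poly.eval (ε R.coordX) := by
  rw [← map_pow, ← map_sub, coordY_pow_sub, map_mul, algHom_aeval, coe_aeval_eq_eval]

/-- At a point `(u, v)`, `x - u` generates the maximal ideal locally. For `f = y`, the product `(y -
v)((y - v)^(p-1) - 1)` equals `x R(x) - u R(u)`, a multiple of `x - u`, and its second factor has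
value `-1` at the point. -/
theorem exists_mul_eq_mul_uniformizer (ε : R.CoordinateRing →ₐ[k] k) (f : R.CoordinateRing) :
    ∃ s g, ε s ≠ 0 ∧
      s * (f - algebraMap k _ (ε f)) = (R.coordX - algebraMap k _ (ε R.coordX)) * g := by
  have : CharP k p := charP
  have : CharP R.CoordinateRing p :=
    charP_of_injective_algebraMap (algebraMap k R.CoordinateRing).injective p
  have hf : f ∈ Algebra.adjoin k {R.coordX, R.coordY} := by
    rw [adjoin_coord]
    trivial
  induction hf using Algebra.adjoin_induction with
  | mem f hf =>
    rcases hf with rfl | rfl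
    · exact ⟨1, 1, by simp, by ring⟩
    · obtain ⟨q, hq⟩ := X_sub_C_dvd_sub_C_eval (a := ε R.coordX) (p := X * R.poly)
      refine ⟨(R.coordY - algebraMap k _ (ε R.coordY)) ^ (p - 1) - 1, aeval R.coordX q, ?_, ?_⟩
      · have : p - 1 ≠ 0 := by have := hp.out.one_lt; omega
        simp [this]
      · have h1 := congrArg (aeval R.coordX) hq
        simp only [map_sub, map_mul, aeval_X, aeval_C, eval_mul, eval_X] at h1
        rw [← R.coordY_pow_sub, ← map_mul, ← hom_pow_sub ε] at h1
        rw [← h1, sub_mul, one_mul, pow_sub_one_mul hp.out.ne_zero, sub_pow_char, map_sub, map_pow]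
        ring
  | algebraMap c => exact ⟨1, 0, by simp, by simp⟩
  | add f f' _ _ h h' =>
    obtain ⟨s, g, hs, h⟩ := h
    obtain ⟨s', g', hs', h'⟩ := h'
    refine ⟨s * s', s' * g + s * g', by simp [hs, hs'], ?_⟩
    rw [map_add, map_add]
    linear_combination s' * h + s * h'
  | mul f f' _ _ h h' =>
    obtain ⟨s, g, hs, h⟩ := h
    obtain ⟨s', g', hs', h'⟩ := h'
    refine ⟨s * s', s * f * g' + s' * algebraMap k _ (ε f') * g, by simp [hs, hs'], ?_⟩
    rw [map_mul, map_mul]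
    linear_combination s * f * h' + s' * algebraMap k _ (ε f') * h

/-- `f` divides a nonzero polynomial in `x`, in which the uniformizer occurs to a finite power. This
bounds how often it can be split off from `f`. -/
theorem exists_mul_eq_uniformizer_pow (ε : R.CoordinateRing →ₐ[k] k) {f : R.CoordinateRing}
    (hf : f ≠ 0) : ∃ n s g, ε s ≠ 0 ∧ ε g ≠ 0 ∧
      s * f = (R.coordX - algebraMap k _ (ε R.coordX)) ^ n * g := by
  set t := R.coordX - algebraMap k _ (ε R.coordX) with ht
  have ht0 : t ≠ 0 := R.coordX_sub_ne_zero _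
  have key : ∀ (r : ℕ) (f h s : R.CoordinateRing), ε s ≠ 0 → f * h = s * t ^ r →
      ∃ n s g, ε s ≠ 0 ∧ ε g ≠ 0 ∧ s * f = t ^ n * g := by
    intro r
    induction r with
    | zero =>
      intro f h s hs hfh
      have : ε f ≠ 0 := by
        intro h0
        have := congrArg ε hfh
        simp only [map_mul, h0, zero_mul, pow_zero, mul_one] at this
        exact hs this.symm
      exact ⟨0, 1, f, by simp, this, by ring⟩
    | succ r ih =>
      intro f h s hs hfh
      by_cases h0 : ε f = 0
      · obtain ⟨s₁, g, hs₁, hg⟩ := exists_mul_eq_mul_uniformizer ε f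
        rw [h0, map_zero, sub_zero] at hg
        obtain ⟨n, s₂, g₂, hs₂, hg₂, h₂⟩ := ih g h (s₁ * s) (by simp [hs, hs₁]) (by
          refine mul_left_cancel₀ ht0 ?_
          linear_combination s₁ * hfh - h * hg)
        refine ⟨n + 1, s₂ * s₁, g₂, by simp [hs₁, hs₂], hg₂, ?_⟩
        linear_combination s₂ * hg + t * h₂
      · exact ⟨0, 1, f, by simp, h0, by ring⟩
  obtain ⟨N, hN, h, hh⟩ := R.exists_dvd_aeval hf
  obtain ⟨q, hq, hq'⟩ := exists_eq_pow_rootMultiplicity_mul_and_not_dvd N hN (ε R.coordX)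
  refine key (N.rootMultiplicity (ε R.coordX)) f h (aeval R.coordX q) ?_ ?_
  · rwa [algHom_aeval, coe_aeval_eq_eval, Ne, ← IsRoot.def, ← dvd_iff_isRoot]
  · rw [← hh]
    conv_lhs => rw [hq]
    rw [map_mul, map_pow, map_sub, aeval_X, aeval_C, mul_comm]

theorem exists_localRing_of_le (ε : R.CoordinateRing →ₐ[k] k) {z : R.FunctionField}
    {f g s₁ s₂ f' g' : R.CoordinateRing} (hz : z * algebraMap _ _ g = algebraMap _ _ f)
    {m n : ℕ} (hmn : m ≤ n) (hs₁ : ε s₁ ≠ 0) (hg' : ε g' ≠ 0)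
    (h₁ : s₁ * f = (R.coordX - algebraMap k _ (ε R.coordX)) ^ n * f')
    (h₂ : s₂ * g = (R.coordX - algebraMap k _ (ε R.coordX)) ^ m * g') :
    ∃ f g : R.CoordinateRing, ε g ≠ 0 ∧ z * algebraMap _ _ g = algebraMap _ _ f := by
  obtain ⟨l, rfl⟩ := Nat.exists_eq_add_of_le hmn
  set t := R.coordX - algebraMap k _ (ε R.coordX) with ht
  have ht0 : t ≠ 0 := R.coordX_sub_ne_zero _
  refine ⟨s₂ * t ^ l * f', s₁ * g', by simp [hs₁, hg'], ?_⟩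
  have ht0' : algebraMap R.CoordinateRing R.FunctionField (t ^ m) ≠ 0 := by
    rw [Ne, IsFractionRing.to_map_eq_zero_iff]
    exact pow_ne_zero _ ht0
  refine mul_left_cancel₀ ht0' ?_
  have h₁' := congrArg (algebraMap R.CoordinateRing R.FunctionField) h₁
  have h₂' := congrArg (algebraMap R.CoordinateRing R.FunctionField) h₂
  rw [pow_add] at h₁'
  simp only [map_mul] at h₁' h₂' ⊢
  linear_combination -(z * algebraMap _ R.FunctionField s₁) * h₂' +
    algebraMap _ R.FunctionField s₂ * h₁' +
    algebraMap _ R.FunctionField s₁ * algebraMap _ R.FunctionField s₂ * hz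

/-- The local ring of the affine curve at a point. -/
noncomputable def localRingAt (ε : R.CoordinateRing →ₐ[k] k) :
    ValuationSubring R.FunctionField where
  carrier := {z | ∃ f g : R.CoordinateRing, ε g ≠ 0 ∧ z * algebraMap _ _ g = algebraMap _ _ f}
  mul_mem' := by
    rintro z z' ⟨f, g, hg, h⟩ ⟨f', g', hg', h'⟩
    refine ⟨f * f', g * g', by simp [hg, hg'], ?_⟩
    rw [map_mul, map_mul, ← h, ← h']
    ring
  one_mem' := ⟨1, 1, by simp, by simp⟩
  add_mem' := by
    rintro z z' ⟨f, g, hg, h⟩ ⟨f', g', hg', h'⟩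
    refine ⟨f * g' + f' * g, g * g', by simp [hg, hg'], ?_⟩
    rw [map_add, map_mul, map_mul, map_mul, ← h, ← h']
    ring
  zero_mem' := ⟨0, 1, by simp, by simp⟩
  neg_mem' := by
    rintro z ⟨f, g, hg, h⟩
    exact ⟨-f, g, hg, by rw [map_neg, ← h]; ring⟩
  mem_or_inv_mem' := by
    intro z
    by_cases hz0 : z = 0
    · exact Or.inl ⟨0, 1, by simp, by simp [hz0]⟩
    obtain ⟨f, g, hg, rfl⟩ := IsFractionRing.div_surjective (A := R.CoordinateRing) z
    have hg0 : g ≠ 0 := nonZeroDivisors.ne_zero hg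
    have hg0' : algebraMap R.CoordinateRing R.FunctionField g ≠ 0 := by
      rwa [Ne, IsFractionRing.to_map_eq_zero_iff]
    have hf0 : f ≠ 0 := by
      rintro rfl
      simp at hz0
    have hf0' : algebraMap R.CoordinateRing R.FunctionField f ≠ 0 := by
      rwa [Ne, IsFractionRing.to_map_eq_zero_iff]
    obtain ⟨n, s₁, f', hs₁, hf', h₁⟩ := exists_mul_eq_uniformizer_pow ε hf0
    obtain ⟨m, s₂, g', hs₂, hg', h₂⟩ := exists_mul_eq_uniformizer_pow ε hg0
    rcases le_total m n with hmn | hmn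
    · exact Or.inl (exists_localRing_of_le ε (div_mul_cancel₀ _ hg0') hmn hs₁ hg' h₁ h₂)
    · refine Or.inr (exists_localRing_of_le ε ?_ hmn hs₂ hf' h₂ h₁)
      rw [inv_div, div_mul_cancel₀ _ hf0']

theorem algebraMap_mem_localRingAt (ε : R.CoordinateRing →ₐ[k] k) (f : R.CoordinateRing) :
    algebraMap _ _ f ∈ localRingAt ε := ⟨f, 1, by simp, by simp⟩

theorem inv_algebraMap_not_mem_localRingAt {ε : R.CoordinateRing →ₐ[k] k} {f : R.CoordinateRing}
    (hf : f ≠ 0) (h : ε f = 0) : (algebraMap _ _ f)⁻¹ ∉ localRingAt ε := by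
  rintro ⟨f', g, hg, hfg⟩
  have hf0' : algebraMap R.CoordinateRing R.FunctionField f ≠ 0 := by
    rwa [Ne, IsFractionRing.to_map_eq_zero_iff]
  rw [inv_mul_eq_iff_eq_mul₀ hf0', ← map_mul] at hfg
  have := IsFractionRing.injective R.CoordinateRing R.FunctionField hfg
  rw [this, map_mul, h, zero_mul] at hg
  exact hg rfl

/-- The point of the curve with given values of the regular functions on the affine curve. -/
noncomputable def pointOf (ε : R.CoordinateRing →ₐ[k] k) : R.CurvePoint where
  localRing := localRingAt ε
  algebraMap_mem c := by
    rw [IsScalarTower.algebraMap_apply k R.CoordinateRing R.FunctionField]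
    exact algebraMap_mem_localRingAt ε _
  ne_top h := by
    refine inv_algebraMap_not_mem_localRingAt (R.coordX_sub_ne_zero (ε R.coordX)) (ε := ε)
      (by simp) ?_
    rw [h]
    trivial

theorem hasValue_pointOf (ε : R.CoordinateRing →ₐ[k] k) (f : R.CoordinateRing) :
    (pointOf ε).HasValue (algebraMap _ _ f) (ε f) := by
  rw [Point.HasValue, IsScalarTower.algebraMap_apply k R.CoordinateRing R.FunctionField, ← map_sub,
    ValuationSubring.mem_nonunits_iff_or]
  by_cases h : f - algebraMap k R.CoordinateRing (ε f) = 0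
  · left
    rw [h, map_zero]
  · exact Or.inr (inv_algebraMap_not_mem_localRingAt h (by simp))

/-- The local ring of `P` dominates `localRingAt ε`, and valuation rings are maximal for domination.
-/
theorem eq_pointOf {P : R.CurvePoint} {ε : R.CoordinateRing →ₐ[k] k}
    (h : ∀ f, P.HasValue (algebraMap _ _ f) (ε f)) : P = pointOf ε := by
  have key : ∀ z, z ∈ localRingAt ε → z ∈ P.localRing ∧
      (z⁻¹ ∉ localRingAt ε → z ∈ P.localRing.nonunits) := by
    rintro z ⟨f, g, hg, hz⟩
    have hg1 : algebraMap R.CoordinateRing R.FunctionField g ∉ P.localRing.nonunits := by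
      intro hn
      refine hg ((h g).unique ?_)
      rwa [Point.HasValue, map_zero, sub_zero]
    rw [ValuationSubring.mem_nonunits_iff_or, not_or, not_not] at hg1
    rw [← eq_mul_inv_iff_mul_eq₀ hg1.1] at hz
    refine ⟨hz ▸ mul_mem (h f).mem hg1.2, fun hz' => ?_⟩
    have hf : ε f = 0 := by
      by_contra hf
      refine hz' ⟨g, f, hf, ?_⟩
      have hf0 : algebraMap R.CoordinateRing R.FunctionField f ≠ 0 := by
        rw [Ne, IsFractionRing.to_map_eq_zero_iff]
        rintro rfl
        exact hf (map_zero ε)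
      rw [hz, mul_inv, inv_inv, mul_comm, ← mul_assoc, mul_inv_cancel₀ hf0, one_mul]
    have hfn := h f
    rw [hf, Point.HasValue, map_zero, sub_zero, ValuationSubring.mem_nonunits_iff] at hfn
    rw [ValuationSubring.mem_nonunits_iff, hz, map_mul]
    exact mul_lt_one_of_lt_of_le hfn ((P.localRing.valuation_le_one_iff _).mpr hg1.2)
  refine Point.ext' fun z => ⟨fun hz => ?_, fun hz => (key z hz).1⟩
  by_contra hz'
  have h1 := ((localRingAt ε).mem_or_inv_mem z).resolve_left hz'
  have h2 := (key _ h1).2 (by rwa [inv_inv])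
  rw [ValuationSubring.inv_mem_nonunits_iff] at h2
  rcases h2 with rfl | h2
  · exact hz' (zero_mem _)
  · exact h2 hz

theorem eq_of_hasValue_pointOf {ε : R.CoordinateRing →ₐ[k] k} {f : R.CoordinateRing} {v : k}
    (h : (pointOf ε).HasValue (algebraMap _ _ f) v) : ε f = v :=
  (hasValue_pointOf ε f).unique h

theorem pointOf_injective : Function.Injective (pointOf (R := R)) := by
  intro ε ε' h
  refine AlgHom.ext fun f => ?_
  refine (hasValue_pointOf ε f).unique ?_
  rw [h]
  exact hasValue_pointOf ε' f

theorem isAffine_pointOf (ε : R.CoordinateRing →ₐ[k] k) : R.IsAffine (pointOf ε) :=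
  ⟨algebraMap_mem_localRingAt ε R.coordX, algebraMap_mem_localRingAt ε R.coordY⟩

theorem algebraMap_mem_of_isAffine {P : R.CurvePoint} (hP : R.IsAffine P) (f : R.CoordinateRing) :
    algebraMap _ _ f ∈ P.localRing := by
  have hf : f ∈ Algebra.adjoin k {R.coordX, R.coordY} := by
    rw [adjoin_coord]
    trivial
  induction hf using Algebra.adjoin_induction with
  | mem f hf =>
    rcases hf with rfl | rfl
    exacts [hP.1, hP.2]
  | algebraMap c =>
    rw [← IsScalarTower.algebraMap_apply k R.CoordinateRing R.FunctionField]
    exact P.algebraMap_mem c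
  | add f g _ _ hf hg => rw [map_add]; exact add_mem hf hg
  | mul f g _ _ hf hg => rw [map_mul]; exact mul_mem hf hg

variable [IsAlgClosed k]

omit hp [Algebra (ZMod p) k] in
theorem exists_sub_mem_of_aeval_mem {A : Type*} [CommRing A] [Algebra k A] {M : Ideal A}
    (hM : M.IsPrime) {z : A} {q : k[X]} (hq : q ≠ 0) (h : aeval z q ∈ M) :
    ∃ v, q.eval v = 0 ∧ z - algebraMap k A v ∈ M := by
  have hs := (IsAlgClosed.splits q).eq_prod_roots
  rw [hs, map_mul, aeval_C, map_multiset_prod, Multiset.map_map] at h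
  rcases hM.mem_or_mem h with h | h
  · exact absurd (Ideal.eq_top_of_isUnit_mem _ h
      ((isUnit_iff_ne_zero.mpr (leadingCoeff_ne_zero.mpr hq)).map (algebraMap k A))) hM.ne_top
  · obtain ⟨w, hw, hvM⟩ := (hM.multiset_prod_mem_iff_exists_mem _).mp h
    obtain ⟨v, hv, rfl⟩ := Multiset.mem_map.mp hw
    refine ⟨v, (mem_roots hq).mp hv, ?_⟩
    simpa using hvM

/-- `M` contains a nonzero polynomial in `x`. It splits into linear factors, so `x - u ∈ M` for some
`u`. Then `y^p - y - u R(u) ∈ M` also splits, and the quotient by `M` is `k`. -/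
theorem exists_hom_of_isPrime {M : Ideal R.CoordinateRing} (hM : M.IsPrime) (hM0 : M ≠ ⊥) :
    ∃ ε : R.CoordinateRing →ₐ[k] k, ∀ f, f ∈ M ↔ ε f = 0 := by
  obtain ⟨f, hf, hf0⟩ := Submodule.exists_mem_ne_zero_of_ne_bot hM0
  obtain ⟨N, hN, hfN⟩ := R.exists_dvd_aeval hf0
  obtain ⟨u, -, hu⟩ := exists_sub_mem_of_aeval_mem hM hN (M.mem_of_dvd hfN hf)
  have hdeg : (X ^ p - X - C (u * R.poly.eval u) : k[X]) ≠ 0 := by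
    intro h
    have h1 := natDegree_X_pow_sub_X_sub_C hp.out.one_lt (u * R.poly.eval u)
    rw [h, natDegree_zero] at h1
    exact hp.out.ne_zero h1.symm
  obtain ⟨v, hv, hv'⟩ := exists_sub_mem_of_aeval_mem hM hdeg (z := R.coordY) (by
    obtain ⟨q, hq⟩ := X_sub_C_dvd_sub_C_eval (a := u) (p := X * R.poly)
    have h1 := congrArg (aeval R.coordX) hq
    simp only [map_sub, map_mul, aeval_X, aeval_C, eval_mul, eval_X] at h1
    rw [map_sub, map_sub, map_pow, aeval_X, aeval_C, coordY_pow_sub, map_mul, h1]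
    exact M.mul_mem_right _ hu)
  have hv2 : v ^ p - v = u * aeval u R.poly := by
    simp only [eval_sub, eval_pow, eval_X, eval_C] at hv
    rw [coe_aeval_eq_eval]
    exact sub_eq_zero.mp hv
  refine ⟨R.lift u v hv2, fun f => ?_⟩
  have : Ideal.Quotient.mkₐ k M = (Algebra.ofId k (R.CoordinateRing ⧸ M)).comp (R.lift u v hv2) := by
    refine algHom_ext ?_ ?_
    · rw [AlgHom.comp_apply, lift_coordX, Algebra.ofId_apply,
        IsScalarTower.algebraMap_apply k R.CoordinateRing]
      exact Ideal.Quotient.mk_eq_mk_iff_sub_mem _ _ |>.mpr hu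
    · rw [AlgHom.comp_apply, lift_coordY, Algebra.ofId_apply,
        IsScalarTower.algebraMap_apply k R.CoordinateRing]
      exact Ideal.Quotient.mk_eq_mk_iff_sub_mem _ _ |>.mpr hv'
  have h1 := DFunLike.congr_fun this f
  rw [AlgHom.comp_apply, Algebra.ofId_apply] at h1
  have : Nontrivial (R.CoordinateRing ⧸ M) := Ideal.Quotient.nontrivial_iff.mpr hM.ne_top
  rw [← Ideal.Quotient.eq_zero_iff_mem, ← Ideal.Quotient.mkₐ_eq_mk k, h1,
    map_eq_zero_iff _ (algebraMap k (R.CoordinateRing ⧸ M)).injective]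

theorem exists_eq_pointOf {P : R.CurvePoint} (hP : R.IsAffine P) : ∃ ε, P = pointOf ε := by
  let ψ : R.CoordinateRing →+* P.localRing :=
    (algebraMap R.CoordinateRing R.FunctionField).codRestrict P.localRing.toSubring
      (algebraMap_mem_of_isAffine hP)
  let M := (IsLocalRing.maximalIdeal P.localRing).comap ψ
  have hmem : ∀ f, f ∈ M ↔ algebraMap _ _ f ∈ P.localRing.nonunits := fun f =>
    ValuationSubring.coe_mem_nonunits_iff.symm
  -- If the centre of `P` were the zero ideal, all nonzero elements of the coordinate ring would be
  -- units at `P`, and the local ring would be the whole field.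
  have hM0 : M ≠ ⊥ := by
    intro h
    refine P.ne_top (eq_top_iff.mpr fun z _ => ?_)
    obtain ⟨f, g, hg, rfl⟩ := IsFractionRing.div_surjective (A := R.CoordinateRing) z
    have hg0 : g ∉ M := by
      rw [h]
      exact nonZeroDivisors.ne_zero hg
    rw [hmem, ValuationSubring.mem_nonunits_iff_or, not_or, not_not] at hg0
    rw [div_eq_mul_inv]
    exact mul_mem (algebraMap_mem_of_isAffine hP f) hg0.2
  obtain ⟨ε, hε⟩ := exists_hom_of_isPrime (M := M) inferInstance hM0
  refine ⟨ε, eq_pointOf fun f => ?_⟩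
  rw [Point.HasValue, IsScalarTower.algebraMap_apply k R.CoordinateRing R.FunctionField, ← map_sub,
    ← hmem, hε]
  simp

theorem exists_eq_algebraMap {z : R.FunctionField} (hz : ∀ ε, z ∈ (pointOf (R := R) ε).localRing) :
    ∃ f : R.CoordinateRing, z = algebraMap _ _ f := by
  -- The ideal of denominators of `z`. If it were proper, all its elements would vanish at some
  -- affine point, contrary to `z` being defined there.
  let D : Ideal R.CoordinateRing :=
    { carrier := {g | ∃ f : R.CoordinateRing, z * algebraMap _ _ g = algebraMap _ _ f}
      add_mem' := by
        rintro g g' ⟨f, hf⟩ ⟨f', hf'⟩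
        exact ⟨f + f', by rw [map_add, map_add, mul_add, hf, hf']⟩
      zero_mem' := ⟨0, by simp⟩
      smul_mem' := by
        rintro c g ⟨f, hf⟩
        exact ⟨c * f, by rw [smul_eq_mul, map_mul, map_mul, ← hf]; ring⟩ }
  by_cases hD : D = ⊤
  · obtain ⟨f, hf⟩ : (1 : R.CoordinateRing) ∈ D := by
      rw [hD]
      trivial
    exact ⟨f, by simpa using hf⟩
  · obtain ⟨M, hM, hDM⟩ := D.exists_le_maximal hD
    have hM0 : M ≠ ⊥ := by
      obtain ⟨f, g, hg, hfg⟩ := IsFractionRing.div_surjective (A := R.CoordinateRing) z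
      have hg0 := nonZeroDivisors.ne_zero hg
      have hg0' : algebraMap R.CoordinateRing R.FunctionField g ≠ 0 := by
        rwa [Ne, IsFractionRing.to_map_eq_zero_iff]
      have : g ∈ M := hDM ⟨f, by rw [← hfg, div_mul_cancel₀ _ hg0']⟩
      rintro rfl
      exact hg0 this
    obtain ⟨ε, hε⟩ := exists_hom_of_isPrime hM.isPrime hM0
    obtain ⟨f, g, hg, hfg⟩ := hz ε
    exact absurd ((hε g).mp (hDM ⟨f, hfg⟩)) hg

variable (R) in
omit [Algebra (ZMod p) k] in
theorem exists_hom_coordX (u : k) : ∃ ε : R.CoordinateRing →ₐ[k] k, ε R.coordX = u := by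
  obtain ⟨v, hv⟩ := exists_pow_sub_eq (p := p) (u * R.poly.eval u)
  exact ⟨R.lift u v (by rw [coe_aeval_eq_eval, hv]), R.lift_coordX _⟩

theorem eq_zero_of_forall_hom {f : R.CoordinateRing} (h : ∀ ε : R.CoordinateRing →ₐ[k] k, ε f = 0) :
    f = 0 := by
  by_contra hf
  obtain ⟨N, hN, g, hg⟩ := R.exists_dvd_aeval hf
  have : Infinite k := IsAlgClosed.instInfinite
  refine hN (Polynomial.funext fun u => ?_)
  obtain ⟨ε, rfl⟩ := R.exists_hom_coordX u
  have h1 := congrArg ε hg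
  rw [algHom_aeval, coe_aeval_eq_eval, map_mul, h, zero_mul] at h1
  rw [h1, eval_zero]

end AffinePoints

end AdditivePoly

end ASCurve

namespace ASCurve

namespace AdditivePoly

variable {p : ℕ} [hp : Fact p.Prime] {k : Type*} [Field k] (R : AdditivePoly p k)

/-! ### The weight of a regular function on the affine curve -/

/-- The polynomial of degree less than `p` in `y` that represents a regular function. -/
noncomputable def rep : R.CoordinateRing →ₗ[k[X]] k[X][X] :=
  AdjoinRoot.modByMonicHom R.monic_equation

theorem mk_rep (f : R.CoordinateRing) : AdjoinRoot.mk R.equation (R.rep f) = f :=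
  AdjoinRoot.mk_leftInverse R.monic_equation f

theorem rep_mk {F : k[X][X]} (hF : F.degree < p) : R.rep (AdjoinRoot.mk R.equation F) = F := by
  rw [rep, AdjoinRoot.modByMonicHom_mk, modByMonic_eq_self_iff R.monic_equation,
    degree_eq_natDegree R.monic_equation.ne_zero, natDegree_equation]
  exact hF

theorem degree_rep_lt (f : R.CoordinateRing) : (R.rep f).degree < p := by
  obtain ⟨F, rfl⟩ := AdjoinRoot.mk_surjective f
  rw [rep, AdjoinRoot.modByMonicHom_mk]
  refine (degree_modByMonic_lt F R.monic_equation).trans_eq ?_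
  rw [degree_eq_natDegree R.monic_equation.ne_zero, natDegree_equation]

theorem rep_ne_zero {f : R.CoordinateRing} (hf : f ≠ 0) : R.rep f ≠ 0 := by
  intro h
  have := R.mk_rep f
  rw [h, map_zero] at this
  exact hf this.symm

theorem lt_of_mem_support_rep {f : R.CoordinateRing} {j : ℕ} (hj : j ∈ (R.rep f).support) :
    j < p := by
  have := (le_degree_of_mem_supp j hj).trans_lt (R.degree_rep_lt f)
  exact_mod_cast this

omit hp in
theorem mk_eq_sum (F : k[X][X]) : AdjoinRoot.mk R.equation F =
    ∑ j ∈ F.support, aeval R.coordX (F.coeff j) * R.coordY ^ j := by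
  conv_lhs => rw [F.as_sum_support_C_mul_X_pow]
  rw [map_sum]
  refine Finset.sum_congr rfl fun j _ => ?_
  rw [map_mul, map_pow, AdjoinRoot.mk_C, AdjoinRoot.mk_X, of_eq_aeval]
  rfl

/-- The weight of the monomials `x ^ (degree N) y ^ j`. -/
noncomputable def termWeight (F : k[X][X]) (j : ℕ) : ℕ :=
  p * (F.coeff j).natDegree + j * (p ^ R.h + 1)

/-- The pole order at infinity of a regular function on the affine curve. -/
noncomputable def weight (f : R.CoordinateRing) : ℕ :=
  (R.rep f).support.sup (R.termWeight (R.rep f))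

theorem exists_weight_eq {f : R.CoordinateRing} (hf : f ≠ 0) :
    ∃ j ∈ (R.rep f).support, R.weight f = R.termWeight (R.rep f) j :=
  Finset.exists_mem_eq_sup _ (support_nonempty.mpr (R.rep_ne_zero hf)) _

theorem termWeight_le_weight {f : R.CoordinateRing} {j : ℕ} (hj : j ∈ (R.rep f).support) :
    R.termWeight (R.rep f) j ≤ R.weight f := Finset.le_sup hj

/-- Modulo `p` the weight is `j (p^h + 1)`, and `p^h + 1` is invertible there. -/
theorem termWeight_injOn (hp2 : p ≠ 2) {F : k[X][X]} {i j : ℕ} (hi : i < p) (hj : j < p)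
    (h : R.termWeight F i = R.termWeight F j) : i = j := by
  have h1 : i * (p ^ R.h + 1) ≡ j * (p ^ R.h + 1) [MOD p] := by
    have := congrArg (· % p) h
    simpa [termWeight, Nat.ModEq] using this
  have h2 := Nat.ModEq.cancel_right_of_coprime (coprime_prime_pow_add_one hp.out hp2 R.h) h1
  exact h2.eq_of_lt_of_lt hi hj

theorem rep_coordX : R.rep R.coordX = C X := by
  refine R.rep_mk (F := C X) (degree_C_le.trans_lt ?_)
  exact_mod_cast hp.out.pos

theorem rep_coordY : R.rep R.coordY = X := by
  refine R.rep_mk (F := X) (degree_X_le.trans_lt ?_)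
  exact_mod_cast hp.out.one_lt

theorem coordX_ne_zero : R.coordX ≠ 0 := by
  simpa using R.coordX_sub_ne_zero 0

theorem coordY_ne_zero : R.coordY ≠ 0 := by
  intro h
  have := R.rep_coordY
  rw [h, map_zero] at this
  exact X_ne_zero this.symm

theorem weight_coordX : R.weight R.coordX = p := by
  rw [weight, rep_coordX, support_C X_ne_zero, Finset.sup_singleton]
  simp [termWeight]

theorem weight_coordY : R.weight R.coordY = p ^ R.h + 1 := by
  rw [weight, rep_coordY, support_X, Finset.sup_singleton]
  simp [termWeight]

theorem eq_zero_of_add_mul_coordY_eq_zero {M N : k[X]}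
    (h : aeval R.coordX M + aeval R.coordX N * R.coordY = 0) : M = 0 ∧ N = 0 := by
  have hdeg : (C M + C N * X : k[X][X]).degree < (p : ℕ) := by
    rw [add_comm]
    refine degree_linear_le.trans_lt ?_
    exact_mod_cast hp.out.one_lt
  have h1 := R.rep_mk hdeg
  rw [map_add, map_mul, AdjoinRoot.mk_C, AdjoinRoot.mk_C, AdjoinRoot.mk_X, of_eq_aeval,
    of_eq_aeval] at h1
  have h2 : R.rep 0 = C M + C N * X := by
    rw [← h1]
    exact congrArg R.rep h.symm
  rw [map_zero] at h2
  constructor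
  · simpa using (congrArg (coeff · 0) h2).symm
  · simpa using (congrArg (coeff · 1) h2).symm

/-! ### The point at infinity -/

section Infinity

variable [Algebra (ZMod p) k] {R}

/-- `y` is integral over `k[x]`, so a pole of `y` is a pole of `x`. -/
theorem x_not_mem_of_not_isAffine {P : R.CurvePoint} (hP : ¬ R.IsAffine P) :
    R.x ∉ P.localRing := by
  intro hx
  refine hP ⟨hx, ?_⟩
  have hx' : ∀ N : k[X], algebraMap _ R.FunctionField (aeval R.coordX N) ∈ P.localRing := by
    intro N
    induction N using Polynomial.induction_on' with
    | add M N hM hN => rw [map_add, map_add]; exact add_mem hM hN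
    | monomial n c =>
      rw [aeval_monomial, map_mul, map_pow,
        ← IsScalarTower.algebraMap_apply k R.CoordinateRing R.FunctionField]
      exact mul_mem (P.algebraMap_mem c) (pow_mem hx n)
  have h1 := congrArg (algebraMap R.CoordinateRing R.FunctionField) R.coordY_pow_sub
  rw [map_sub, map_pow, map_mul] at h1
  have h2 : R.y ^ p - R.y ∈ P.localRing := by
    change algebraMap R.CoordinateRing R.FunctionField R.coordY ^ p - _ ∈ _
    rw [y, ← coordY, h1]
    exact mul_mem hx (hx' _)
  by_contra hy
  rw [← P.localRing.valuation_le_one_iff, not_le] at hy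
  rw [← P.localRing.valuation_le_one_iff, Valuation.map_sub_eq_of_lt_left, map_pow] at h2
  · exact absurd h2 (not_le.mpr (one_lt_pow₀ hy hp.out.ne_zero))
  · rw [map_pow]
    exact lt_self_pow₀ hy hp.out.one_lt

theorem one_lt_valuation_x {P : R.CurvePoint} (hP : ¬ R.IsAffine P) :
    1 < P.localRing.valuation R.x := by
  rw [← not_le, P.localRing.valuation_le_one_iff]
  exact x_not_mem_of_not_isAffine hP

theorem valuation_aeval_le {P : R.CurvePoint} (hP : ¬ R.IsAffine P) (N : k[X]) :
    P.localRing.valuation (algebraMap _ _ (aeval R.coordX N))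
      ≤ P.localRing.valuation R.x ^ N.natDegree := by
  rw [aeval_eq_sum_range, map_sum]
  refine Valuation.map_sum_le _ fun i hi => ?_
  rw [Algebra.smul_def, map_mul, map_mul, map_pow, map_pow,
    ← IsScalarTower.algebraMap_apply k R.CoordinateRing R.FunctionField]
  refine (mul_le_of_le_one_left' (Point.valuation_algebraMap_le _)).trans ?_
  exact pow_le_pow_right₀ (one_lt_valuation_x hP).le (Finset.mem_range_succ_iff.mp hi)

theorem valuation_aeval {P : R.CurvePoint} (hP : ¬ R.IsAffine P) {N : k[X]} (hN : N ≠ 0) :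
    P.localRing.valuation (algebraMap _ _ (aeval R.coordX N))
      = P.localRing.valuation R.x ^ N.natDegree := by
  have h1 : P.localRing.valuation
      (algebraMap _ R.FunctionField (aeval R.coordX (C N.leadingCoeff * X ^ N.natDegree)))
      = P.localRing.valuation R.x ^ N.natDegree := by
    rw [map_mul, map_mul, map_mul, aeval_C, map_pow, map_pow, map_pow, aeval_X,
      ← IsScalarTower.algebraMap_apply k R.CoordinateRing R.FunctionField,
      Point.valuation_algebraMap (leadingCoeff_ne_zero.mpr hN), one_mul]
    rfl
  conv_lhs => rw [← N.eraseLead_add_C_mul_X_pow]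
  rw [map_add, map_add, Valuation.map_add_eq_of_lt_right, h1]
  rw [h1]
  rcases N.eraseLead_natDegree_lt_or_eraseLead_eq_zero with h | h
  · exact (valuation_aeval_le hP _).trans_lt (pow_lt_pow_right₀ (one_lt_valuation_x hP) h)
  · rw [h, map_zero, map_zero, map_zero]
    exact pow_pos (zero_lt_one.trans (one_lt_valuation_x hP)) _

theorem valuation_y_pow {P : R.CurvePoint} (hP : ¬ R.IsAffine P) :
    P.localRing.valuation R.y ^ p = P.localRing.valuation R.x ^ (p ^ R.h + 1) := by
  have h0 : (X * R.poly : k[X]) ≠ 0 := by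
    intro h
    have := R.natDegree_X_mul_poly hp.out.one_lt
    rw [h, natDegree_zero] at this
    omega
  have h1 := valuation_aeval hP h0
  rw [R.natDegree_X_mul_poly hp.out.one_lt, map_mul, aeval_X, ← coordY_pow_sub, map_sub, map_pow]
    at h1
  change P.localRing.valuation (R.y ^ p - R.y) = _ at h1
  have hy : 1 < P.localRing.valuation R.y := by
    by_contra hy
    rw [not_lt] at hy
    have h2 : P.localRing.valuation (R.y ^ p - R.y) ≤ 1 := by
      refine Valuation.map_sub_le _ ?_ hy
      rw [map_pow]
      exact pow_le_one₀ zero_le hy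
    rw [h1] at h2
    exact absurd h2 (not_le.mpr (one_lt_pow₀ (one_lt_valuation_x hP) (Nat.succ_ne_zero _)))
  rw [← h1, Valuation.map_sub_eq_of_lt_left, map_pow]
  rw [map_pow]
  exact lt_self_pow₀ hy hp.out.one_lt

/-- The terms `N_j(x) y^j` have distinct weights, hence distinct valuations, so the largest one is
the valuation of the sum. The `p`-th power expresses everything through the valuation of `x`. -/
theorem valuation_algebraMap_pow (hp2 : p ≠ 2) {P : R.CurvePoint} (hP : ¬ R.IsAffine P)
    {f : R.CoordinateRing} (hf : f ≠ 0) :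
    P.localRing.valuation (algebraMap _ _ f) ^ p = P.localRing.valuation R.x ^ R.weight f := by
  classical
  have hterm : ∀ j ∈ (R.rep f).support, P.localRing.valuation (algebraMap _ R.FunctionField
      (aeval R.coordX ((R.rep f).coeff j) * R.coordY ^ j)) ^ p
      = P.localRing.valuation R.x ^ R.termWeight (R.rep f) j := by
    intro j hj
    rw [map_mul, map_mul, valuation_aeval hP (mem_support_iff.mp hj), map_pow, map_pow, mul_pow,
      ← pow_mul, ← pow_mul, mul_comm j p, pow_mul _ p j]
    change _ * (P.localRing.valuation R.y ^ p) ^ j = _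
    rw [valuation_y_pow hP, ← pow_mul, ← pow_add, termWeight]
    congr 1
    ring
  obtain ⟨j, hj, hw⟩ := R.exists_weight_eq hf
  rw [hw, ← hterm j hj]
  conv_lhs => rw [← R.mk_rep f, mk_eq_sum, map_sum]
  rw [Valuation.map_sum_eq_of_lt _ hj]
  intro i hi
  rw [Finset.mem_sdiff, Finset.mem_singleton] at hi
  refine lt_of_pow_lt_pow_left₀ p zero_le ?_
  rw [hterm i hi.1, hterm j hj]
  refine pow_lt_pow_right₀ (one_lt_valuation_x hP) (lt_of_le_of_ne ?_ fun h => hi.2 ?_)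
  · rw [← hw]
    exact R.termWeight_le_weight hi.1
  · exact R.termWeight_injOn hp2 (R.lt_of_mem_support_rep hi.1) (R.lt_of_mem_support_rep hj) h

theorem div_mem_localRing_iff (hp2 : p ≠ 2) {P : R.CurvePoint} (hP : ¬ R.IsAffine P)
    {f g : R.CoordinateRing} (hf : f ≠ 0) (hg : g ≠ 0) :
    algebraMap _ R.FunctionField f / algebraMap _ R.FunctionField g ∈ P.localRing ↔
      R.weight f ≤ R.weight g := by
  have hg0 : algebraMap R.CoordinateRing R.FunctionField g ≠ 0 := by
    rwa [Ne, IsFractionRing.to_map_eq_zero_iff]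
  rw [← P.localRing.valuation_le_one_iff, map_div₀,
    div_le_one₀ (zero_lt_iff.mpr ((Valuation.ne_zero_iff _).mpr hg0)),
    ← pow_le_pow_iff_left₀ zero_le zero_le hp.out.ne_zero, valuation_algebraMap_pow hp2 hP hf,
    valuation_algebraMap_pow hp2 hP hg, pow_le_pow_iff_right₀ (one_lt_valuation_x hP)]

/-- Membership in the local ring is decided by weights alone, whatever the non-affine point. -/
theorem eq_of_not_isAffine (hp2 : p ≠ 2) {P P' : R.CurvePoint} (hP : ¬ R.IsAffine P)
    (hP' : ¬ R.IsAffine P') : P = P' := by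
  refine Point.ext' fun z => ?_
  obtain ⟨f, g, hg, rfl⟩ := IsFractionRing.div_surjective (A := R.CoordinateRing) z
  by_cases hf : f = 0
  · simp [hf, zero_mem]
  · rw [div_mem_localRing_iff hp2 hP hf (nonZeroDivisors.ne_zero hg),
      div_mem_localRing_iff hp2 hP' hf (nonZeroDivisors.ne_zero hg)]

variable (R) in
omit [Algebra (ZMod p) k] in
theorem transcendental_x : Transcendental k R.x := by
  rw [transcendental_iff]
  intro N hN
  rw [x, ← coordX, aeval_algebraMap_apply, IsFractionRing.to_map_eq_zero_iff, ← R.of_eq_aeval] at hN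
  exact R.of_injective (by rw [hN, map_zero])

-- `x⁻¹` is transcendental, hence a non-unit of `k[x⁻¹]`. Some valuation ring containing `k[x⁻¹]`
-- has `x⁻¹` among its non-units, and there `x` has a pole.
variable (R) in
theorem exists_not_isAffine : ∃ P : R.CurvePoint, ¬ R.IsAffine P := by
  have hx0 : R.x ≠ 0 := fun h => R.transcendental_x (h ▸ isAlgebraic_zero)
  let A := (Algebra.adjoin k {R.x⁻¹}).toSubring
  let t : A := ⟨R.x⁻¹, Algebra.subset_adjoin rfl⟩
  have hI : Ideal.span {t} ≠ ⊤ := by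
    intro h
    obtain ⟨⟨c, hc⟩, hct⟩ := Ideal.mem_span_singleton'.mp (h ▸ Submodule.mem_top : (1 : A) ∈ _)
    have hct' : c * R.x⁻¹ = 1 := congrArg Subtype.val hct
    have hc' : c ∈ Algebra.adjoin k {R.x⁻¹} := hc
    rw [Algebra.adjoin_singleton_eq_range_aeval] at hc'
    obtain ⟨N, rfl⟩ := hc'
    refine R.transcendental_x (IsAlgebraic.inv_iff.mp ⟨N * X - 1, ?_, ?_⟩)
    · intro h0
      have := congrArg (eval 0) h0
      simp at this
    · rw [map_sub, map_mul, aeval_X, map_one, sub_eq_zero]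
      exact hct'
  obtain ⟨B, hAB, hB⟩ := Ideal.image_subset_nonunits_valuationSubring _ hI
  have hx : R.x ∉ B := by
    have := hB ⟨t, Ideal.mem_span_singleton_self t, rfl⟩
    have h2 := B.inv_mem_nonunits_iff.mp this
    exact h2.resolve_left hx0
  refine ⟨⟨B, fun c => hAB (Subalgebra.algebraMap_mem (Algebra.adjoin k {R.x⁻¹}) c), ?_⟩,
    fun h => hx h.1⟩
  rintro rfl
  exact hx trivial

end Infinity

end AdditivePoly

/-! ### Automorphisms of the function field -/

namespace Point

variable {k K : Type*} [Field k] [Field K] [Algebra k K]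

/-- The point `P ∘ σ` for an automorphism `σ` of the function field. -/
def pullback (σ : K ≃ₐ[k] K) (P : Point k K) : Point k K where
  localRing := P.localRing.comap σ.toAlgHom.toRingHom
  algebraMap_mem c := by
    change σ (algebraMap k K c) ∈ P.localRing
    rw [σ.commutes]
    exact P.algebraMap_mem c
  ne_top h := by
    refine P.ne_top (eq_top_iff.mpr fun z _ => ?_)
    have : σ.symm z ∈ P.localRing.comap σ.toAlgHom.toRingHom := by
      rw [h]
      trivial
    change σ (σ.symm z) ∈ P.localRing at this
    rwa [σ.apply_symm_apply] at this

theorem mem_pullback {σ : K ≃ₐ[k] K} {P : Point k K} {z : K} :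
    z ∈ (P.pullback σ).localRing ↔ σ z ∈ P.localRing := Iff.rfl

theorem hasValue_pullback {σ : K ≃ₐ[k] K} {P : Point k K} {f : K} {v : k} :
    (P.pullback σ).HasValue f v ↔ P.HasValue (σ f) v := by
  rw [HasValue, HasValue, ValuationSubring.mem_nonunits_iff_or,
    ValuationSubring.mem_nonunits_iff_or, mem_pullback, map_inv₀, map_sub, σ.commutes,
    ← map_eq_zero_iff σ σ.injective, map_sub, σ.commutes]

theorem pullback_pullback {σ τ : K ≃ₐ[k] K} (h : ∀ z, σ (τ z) = z) (P : Point k K) :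
    (P.pullback σ).pullback τ = P := by
  refine ext' fun z => ?_
  rw [mem_pullback, mem_pullback, h]

/-- The permutation of the points induced by an automorphism of the function field. -/
def pullbackPerm (σ : K ≃ₐ[k] K) : Equiv.Perm (Point k K) where
  toFun := pullback σ
  invFun := pullback σ.symm
  left_inv := pullback_pullback σ.apply_symm_apply
  right_inv := pullback_pullback σ.symm_apply_apply

theorem isOpen_iff {U : Set (Point k K)} : IsOpen U ↔ (U.Nonempty → Uᶜ.Finite) := Iff.rfl

theorem continuous_of_injective {φ : Point k K → Point k K} (h : Function.Injective φ) :
    Continuous φ := by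
  rw [continuous_def]
  intro U hU
  rw [isOpen_iff] at hU ⊢
  rintro ⟨P, hP⟩
  rw [← Set.preimage_compl]
  exact (hU ⟨φ P, hP⟩).preimage h.injOn

theorem isMorphism_pullback (σ : K ≃ₐ[k] K) : IsMorphism (pullback σ) := by
  refine ⟨continuous_of_injective (pullbackPerm σ).injective, ?_⟩
  rintro U s - ⟨f, hf⟩
  exact ⟨σ f, fun P hP => hasValue_pullback.mp (hf _ hP)⟩

/-- The automorphism of the curve induced by an automorphism of the function field. -/
def autOf (σ : K ≃ₐ[k] K) : Aut k K :=
  ⟨pullbackPerm σ, isMorphism_pullback σ, isMorphism_pullback σ.symm⟩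

theorem autOf_smul (σ : K ≃ₐ[k] K) (P : Point k K) : autOf σ • P = P.pullback σ := rfl

end Point

end ASCurve

namespace ASCurve

namespace AdditivePoly

variable {p : ℕ} [hp : Fact p.Prime] {k : Type*} [Field k] {R : AdditivePoly p k}

/-! ### Automorphisms of the affine coordinate ring -/

section Weight

variable [Algebra (ZMod p) k]

/-- The automorphism of the function field induced by an automorphism of the coordinate ring. -/
noncomputable def fieldAut (τ : R.CoordinateRing ≃ₐ[k] R.CoordinateRing) :
    R.FunctionField ≃ₐ[k] R.FunctionField :=
  IsFractionRing.algEquivOfAlgEquiv τ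

omit hp [Algebra (ZMod p) k] in
theorem fieldAut_algebraMap (τ : R.CoordinateRing ≃ₐ[k] R.CoordinateRing) (f : R.CoordinateRing) :
    fieldAut τ (algebraMap _ _ f) = algebraMap _ _ (τ f) :=
  IsFractionRing.algEquivOfAlgEquiv_algebraMap τ f

theorem not_isAffine_pullback (τ : R.CoordinateRing ≃ₐ[k] R.CoordinateRing) {P : R.CurvePoint}
    (hP : ¬ R.IsAffine P) : ¬ R.IsAffine (P.pullback (fieldAut τ)) := by
  intro h
  have key : ∀ f, algebraMap R.CoordinateRing R.FunctionField f ∈ P.localRing := by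
    intro f
    have h1 := algebraMap_mem_of_isAffine h (τ.symm f)
    rwa [Point.mem_pullback, fieldAut_algebraMap, τ.apply_symm_apply] at h1
  exact hP ⟨key R.coordX, key R.coordY⟩

theorem weight_le_weight_iff (hp2 : p ≠ 2) (τ : R.CoordinateRing ≃ₐ[k] R.CoordinateRing)
    {f g : R.CoordinateRing} (hf : f ≠ 0) (hg : g ≠ 0) :
    R.weight (τ f) ≤ R.weight (τ g) ↔ R.weight f ≤ R.weight g := by
  obtain ⟨P, hP⟩ := R.exists_not_isAffine
  rw [← div_mem_localRing_iff hp2 (not_isAffine_pullback τ hP) hf hg, Point.mem_pullback, map_div₀,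
    fieldAut_algebraMap, fieldAut_algebraMap,
    div_mem_localRing_iff hp2 hP (by simpa using hf) (by simpa using hg)]

/-- `τ` induces an order automorphism of the set of weights. This set is well-ordered, so the
automorphism is the identity. -/
theorem weight_algEquiv (hp2 : p ≠ 2) (τ : R.CoordinateRing ≃ₐ[k] R.CoordinateRing)
    {f : R.CoordinateRing} (hf : f ≠ 0) : R.weight (τ f) = R.weight f := by
  have key : ∀ (n : ℕ) (f : R.CoordinateRing), f ≠ 0 → R.weight f = n →
      R.weight (τ f) = n := by
    intro n
    induction n using Nat.strong_induction_on with
    | _ n ih =>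
      intro f hf hfn
      rcases lt_trichotomy (R.weight (τ f)) n with h | h | h
      · have h1 := ih _ h (τ f) (by simpa using hf) rfl
        have h2 := (weight_le_weight_iff hp2 τ hf (g := τ f) (by simpa using hf)).mp h1.ge
        omega
      · exact h
      · have hf' : τ.symm f ≠ 0 := by simpa using hf
        have h1 : R.weight (τ.symm f) < n := by
          rw [← hfn, ← not_le, ← weight_le_weight_iff hp2 τ hf hf', τ.apply_symm_apply, not_le, hfn]
          exact h
        have h2 := ih _ h1 (τ.symm f) hf' rfl
        rw [τ.apply_symm_apply] at h2
        omega
  exact key _ f hf rfl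

end Weight

/-! ### Functions with the weight of `x` or of `y` -/

theorem eq_aeval_add_of_forall_mem_support {f : R.CoordinateRing}
    (h : ∀ j ∈ (R.rep f).support, j ≤ 1) :
    f = aeval R.coordX ((R.rep f).coeff 0) + aeval R.coordX ((R.rep f).coeff 1) * R.coordY := by
  have h1 : R.rep f = C ((R.rep f).coeff 1) * X + C ((R.rep f).coeff 0) := by
    refine eq_X_add_C_of_natDegree_le_one (natDegree_le_iff_coeff_eq_zero.mpr fun j hj => ?_)
    by_contra h0
    have := h j (mem_support_iff.mpr h0)
    omega
  have h2 := R.mk_rep f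
  rw [h1, map_add, map_mul, AdjoinRoot.mk_C, AdjoinRoot.mk_C, AdjoinRoot.mk_X, of_eq_aeval,
    of_eq_aeval] at h2
  rw [add_comm]
  exact h2.symm

theorem exists_of_weight_eq_coordY (hp2 : p ≠ 2) {f : R.CoordinateRing} (hf : f ≠ 0)
    (hw : R.weight f = p ^ R.h + 1) :
    ∃ (d : k) (G : k[X]), d ≠ 0 ∧ p * G.natDegree ≤ p ^ R.h + 1 ∧
      f = algebraMap k _ d * R.coordY + aeval R.coordX G := by
  have hle : ∀ j ∈ (R.rep f).support,
      p * ((R.rep f).coeff j).natDegree + j * (p ^ R.h + 1) ≤ p ^ R.h + 1 := fun j hj =>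
    (R.termWeight_le_weight hj).trans_eq hw
  have hle1 : ∀ j ∈ (R.rep f).support, j ≤ 1 := by
    intro j hj
    have := hle j hj
    by_contra h
    have : 2 * (p ^ R.h + 1) ≤ j * (p ^ R.h + 1) := Nat.mul_le_mul_right _ (by omega)
    omega
  obtain ⟨j, hj, hwj⟩ := R.exists_weight_eq hf
  rw [hw, termWeight] at hwj
  -- For `j = 0` the weight would be a multiple of `p`, which `p^h + 1` is not.
  have hj1 : j = 1 := by
    have := hle1 j hj
    interval_cases j
    · exact absurd ⟨_, by simpa using hwj⟩ (not_dvd_prime_pow_add_one hp.out hp2 R.h)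
    · rfl
  subst hj1
  have hdeg : ((R.rep f).coeff 1).natDegree = 0 := by
    have h1 : p * ((R.rep f).coeff 1).natDegree = 0 := by omega
    exact (Nat.mul_eq_zero.mp h1).resolve_left hp.out.ne_zero
  refine ⟨((R.rep f).coeff 1).coeff 0, (R.rep f).coeff 0, ?_, ?_, ?_⟩
  · intro h0
    rw [mem_support_iff, eq_C_of_natDegree_eq_zero hdeg, h0, C_0] at hj
    exact hj rfl
  · by_cases h0 : 0 ∈ (R.rep f).support
    · have := hle 0 h0
      omega
    · rw [notMem_support_iff.mp h0, natDegree_zero]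
      omega
  · conv_lhs => rw [eq_aeval_add_of_forall_mem_support hle1, eq_C_of_natDegree_eq_zero hdeg]
    rw [aeval_C, add_comm]

theorem exists_of_weight_eq_coordX (hh : R.h ≠ 0) {f : R.CoordinateRing} (hf : f ≠ 0)
    (hw : R.weight f = p) :
    ∃ a c : k, a ≠ 0 ∧ f = algebraMap k _ a * R.coordX + algebraMap k _ c := by
  have hlt : p < p ^ R.h + 1 := Nat.lt_succ_of_le (Nat.le_self_pow hh p)
  have hle : ∀ j ∈ (R.rep f).support,
      p * ((R.rep f).coeff j).natDegree + j * (p ^ R.h + 1) ≤ p := fun j hj =>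
    (R.termWeight_le_weight hj).trans_eq hw
  have hj0 : ∀ j ∈ (R.rep f).support, j = 0 := by
    intro j hj
    by_contra h
    have := hle j hj
    have : 1 * (p ^ R.h + 1) ≤ j * (p ^ R.h + 1) := Nat.mul_le_mul_right _ (by omega)
    omega
  obtain ⟨j, hj, hwj⟩ := R.exists_weight_eq hf
  obtain rfl := hj0 j hj
  rw [hw, termWeight, zero_mul, add_zero] at hwj
  have hdeg : ((R.rep f).coeff 0).natDegree = 1 := by
    have : p * 1 = p * ((R.rep f).coeff 0).natDegree := by rw [mul_one]; exact hwj
    exact (Nat.eq_of_mul_eq_mul_left hp.out.pos this).symm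
  have hz : (R.rep f).coeff 1 = 0 := by
    by_contra h
    exact one_ne_zero (hj0 1 (mem_support_iff.mpr h))
  refine ⟨((R.rep f).coeff 0).coeff 1, ((R.rep f).coeff 0).coeff 0, ?_, ?_⟩
  · rw [← hdeg, coeff_natDegree, Ne, leadingCoeff_eq_zero]
    exact mem_support_iff.mp hj
  · conv_lhs => rw [eq_aeval_add_of_forall_mem_support fun j hj => (hj0 j hj).le.trans zero_le_one,
      hz, eq_X_add_C_of_natDegree_le_one hdeg.le]
    simp

/-- For `h = 0`, functions of the weight of `x` are the sum of a multiple of `x` and a polynomial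
in `y`. -/
theorem exists_of_weight_eq_coordX_of_h_eq_zero (hp2 : p ≠ 2) (hh : R.h = 0)
    {f : R.CoordinateRing} (hf : f ≠ 0) (hw : R.weight f = p) :
    ∃ (a : k) (N : k[X]), a ≠ 0 ∧ f = algebraMap k _ a * R.coordX + aeval R.coordY N := by
  have hle : ∀ j ∈ (R.rep f).support,
      p * ((R.rep f).coeff j).natDegree + j * 2 ≤ p := by
    intro j hj
    have := (R.termWeight_le_weight hj).trans_eq hw
    rwa [termWeight, hh, pow_zero] at this
  have hp0 := hp.out.pos
  have hdeg : ∀ j, j ≠ 0 → ((R.rep f).coeff j).natDegree = 0 := by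
    intro j hj
    by_cases hs : j ∈ (R.rep f).support
    · have := hle j hs
      by_contra h0
      have : p * 1 ≤ p * ((R.rep f).coeff j).natDegree := Nat.mul_le_mul_left _ (by omega)
      omega
    · rw [notMem_support_iff.mp hs, natDegree_zero]
  have hdeg0 : ((R.rep f).coeff 0).natDegree ≤ 1 := by
    by_cases hs : 0 ∈ (R.rep f).support
    · have := hle 0 hs
      by_contra h0
      have : p * 2 ≤ p * ((R.rep f).coeff 0).natDegree := Nat.mul_le_mul_left _ (by omega)
      omega
    · rw [notMem_support_iff.mp hs, natDegree_zero]
      omega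
  refine ⟨((R.rep f).coeff 0).coeff 1, ∑ j ∈ (R.rep f).support,
    C (((R.rep f).coeff j).coeff 0) * X ^ j, ?_, ?_⟩
  · obtain ⟨j, hj, hwj⟩ := R.exists_weight_eq hf
    rw [hw, termWeight, hh, pow_zero] at hwj
    by_cases hj0 : j = 0
    · subst hj0
      have : ((R.rep f).coeff 0).natDegree = 1 := by
        have : p * 1 = p * ((R.rep f).coeff 0).natDegree := by omega
        exact (Nat.eq_of_mul_eq_mul_left hp0 this).symm
      rw [← this, coeff_natDegree, Ne, leadingCoeff_eq_zero]
      exact mem_support_iff.mp hj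
    -- A leading term that is a multiple of `y^j` would give `p = 2j`, impossible for odd `p`.
    · rw [hdeg j hj0] at hwj
      exact absurd ((Nat.prime_dvd_prime_iff_eq Nat.prime_two hp.out).mp ⟨j, by omega⟩).symm hp2
  · have key : ∀ j, aeval R.coordX ((R.rep f).coeff j) * R.coordY ^ j
        = (if j = 0 then algebraMap k _ (((R.rep f).coeff 0).coeff 1) * R.coordX else 0)
          + algebraMap k _ (((R.rep f).coeff j).coeff 0) * R.coordY ^ j := by
      intro j
      by_cases hj : j = 0
      · subst hj
        conv_lhs => rw [eq_X_add_C_of_natDegree_le_one hdeg0]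
        simp
      · conv_lhs => rw [eq_C_of_natDegree_eq_zero (hdeg j hj)]
        simp [hj]
    conv_lhs => rw [← R.mk_rep f, mk_eq_sum]
    simp only [key, Finset.sum_add_distrib, map_sum, map_mul, map_pow, aeval_C, aeval_X]
    congr 1
    rw [Finset.sum_ite_eq']
    split_ifs with h0
    · rfl
    · rw [notMem_support_iff.mp h0]
      simp

variable [Algebra (ZMod p) k]

theorem algEquiv_coordX_of_h_eq_zero (hp2 : p ≠ 2) (hh : R.h = 0)
    (τ : R.CoordinateRing ≃ₐ[k] R.CoordinateRing) {d g : k}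
    (hy : τ R.coordY = algebraMap k _ d * R.coordY + algebraMap k _ g) :
    ∃ a : k, a ≠ 0 ∧ τ R.coordX = algebraMap k _ a * R.coordX := by
  have : CharP k p := charP
  obtain ⟨a, N, ha, hx⟩ := exists_of_weight_eq_coordX_of_h_eq_zero hp2 hh
    (f := τ R.coordX) (by simpa using R.coordX_ne_zero)
    (by rw [weight_algEquiv hp2 τ R.coordX_ne_zero, weight_coordX])
  have hpoly : R.poly = C (R.a 0) * X := by
    simp [poly, hh]
  -- For `h = 0` the curve is `y^p - y = a_0 x^2`, with the symmetry `x ↦ -x`. Since `a_0 (τ x)^2`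
  -- is a polynomial in `τ y`, hence in `y`, it is fixed by `ι`, so `ι (τ x) = ± τ x`. The sign `+`
  -- contradicts `a ≠ 0`, and the sign `-` kills the part `N(y)`.
  let ι : R.CoordinateRing →ₐ[k] R.CoordinateRing := R.lift (-R.coordX) R.coordY (by
    rw [coordY_pow_sub, hpoly]
    simp)
  have hιx : ι R.coordX = -R.coordX := R.lift_coordX _
  have hιy : ι R.coordY = R.coordY := R.lift_coordY _
  have hsq : algebraMap k _ (R.a 0) * τ R.coordX ^ 2 = τ R.coordY ^ p - τ R.coordY := by
    rw [← map_pow, ← map_pow, ← map_sub, coordY_pow_sub, hpoly, map_mul, map_mul, map_mul, aeval_C,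
      aeval_X, τ.commutes, map_pow]
    ring
  have hιτ : ι (τ R.coordX) ^ 2 = τ R.coordX ^ 2 := by
    have h1 := congrArg ι hsq
    have h2 : ι (τ R.coordY) = τ R.coordY := by
      rw [hy, map_add, map_mul, ι.commutes, ι.commutes, hιy]
    rw [map_mul, map_pow, ι.commutes, map_sub, map_pow, h2, ← hsq] at h1
    have ha0 : algebraMap k R.CoordinateRing (R.a 0) ≠ 0 := by
      have := R.a_ne_zero
      rw [hh] at this
      rwa [Ne, map_eq_zero_iff _ (algebraMap k R.CoordinateRing).injective]
    exact mul_left_cancel₀ ha0 h1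
  have hιτx : ι (τ R.coordX) = -(algebraMap k _ a * R.coordX) + aeval R.coordY N := by
    rw [hx, map_add, map_mul, ι.commutes, hιx, ← aeval_algHom_apply, hιy, mul_neg]
  have h2 : algebraMap k R.CoordinateRing 2 ≠ 0 := by
    rw [Ne, map_eq_zero_iff _ (algebraMap k R.CoordinateRing).injective]
    exact two_ne_zero_of_charP hp2
  refine ⟨a, ha, ?_⟩
  rw [hιτx, hx, sq_eq_sq_iff_eq_or_eq_neg] at hιτ
  rw [map_ofNat] at h2
  rcases hιτ with h | h
  · exfalso
    have h3 : 2 * (algebraMap k R.CoordinateRing a * R.coordX) = 0 := by linear_combination -h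
    rcases mul_eq_zero.mp ((mul_eq_zero.mp h3).resolve_left h2) with h4 | h4
    · exact ha ((map_eq_zero_iff _ (algebraMap k R.CoordinateRing).injective).mp h4)
    · exact R.coordX_ne_zero h4
  · have h3 : 2 * aeval R.coordY N = 0 := by linear_combination h
    rw [hx, (mul_eq_zero.mp h3).resolve_left h2, add_zero]

theorem exists_algEquiv_coord (hp2 : p ≠ 2) (τ : R.CoordinateRing ≃ₐ[k] R.CoordinateRing) :
    ∃ (a c d : k) (G : k[X]), a ≠ 0 ∧ d ≠ 0 ∧
      τ R.coordX = algebraMap k _ a * R.coordX + algebraMap k _ c ∧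
      τ R.coordY = algebraMap k _ d * R.coordY + aeval R.coordX G := by
  obtain ⟨d, G, hd, hG, hy⟩ := exists_of_weight_eq_coordY hp2
    (f := τ R.coordY) (by simpa using R.coordY_ne_zero)
    (by rw [weight_algEquiv hp2 τ R.coordY_ne_zero, weight_coordY])
  by_cases hh : R.h = 0
  · have hG0 : G.natDegree = 0 := by
      rw [hh, pow_zero] at hG
      by_contra h0
      have h1 : p * 1 ≤ p * G.natDegree := Nat.mul_le_mul_left _ (by omega)
      have := hp.out.two_le
      omega
    obtain ⟨a, ha, hx⟩ := algEquiv_coordX_of_h_eq_zero hp2 hh τ (d := d) (g := G.coeff 0) (by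
      conv_lhs => rw [hy, eq_C_of_natDegree_eq_zero hG0]
      rw [aeval_C])
    exact ⟨a, 0, d, G, ha, hd, by rw [hx, map_zero, add_zero], hy⟩
  · obtain ⟨a, c, ha, hx⟩ := exists_of_weight_eq_coordX hh
      (f := τ R.coordX) (by simpa using R.coordX_ne_zero)
      (by rw [weight_algEquiv hp2 τ R.coordX_ne_zero, weight_coordX])
    exact ⟨a, c, d, G, ha, hd, hx, hy⟩

theorem exists_units_algebraMap_eq {d : k} (hd0 : d ≠ 0) (hd : d ^ p = d) :
    ∃ d' : (ZMod p)ˣ, algebraMap (ZMod p) k d' = d := by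
  have : CharP k p := charP
  have h1 := (Subfield.mem_bot_iff_pow_eq_self (F := k) (p := p)).mpr hd
  have h2 : d ∈ (algebraMap (ZMod p) k).fieldRange := (bot_le : (⊥ : Subfield k) ≤ _) h1
  obtain ⟨d', rfl⟩ := h2
  exact ⟨Units.mk0 d' (by rintro rfl; simp at hd0), rfl⟩

theorem algebraMap_pow_prime (d : ZMod p) :
    algebraMap (ZMod p) k d ^ p = algebraMap (ZMod p) k d := by
  rw [← map_pow, ZMod.pow_card]

/-- Applying `τ` to the equation of the curve gives a relation `M(x) + N(x) y = 0`, so `M` and `N`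
vanish. Here `N = d^p - d`, which puts `d` in the prime field. -/
theorem exists_S_of_algHom {a c d : k} {G : k[X]} (hd0 : d ≠ 0)
    (τ : R.CoordinateRing →ₐ[k] R.CoordinateRing)
    (hx : τ R.coordX = algebraMap k _ a * R.coordX + algebraMap k _ c)
    (hy : τ R.coordY = algebraMap k _ d * R.coordY + aeval R.coordX G) :
    (∃ d' : (ZMod p)ˣ, algebraMap (ZMod p) k d' = d) ∧
      (X * R.poly).comp (C a * X + C c) - C d * (X * R.poly) = G ^ p - G := by
  have : CharP k p := charP
  have : CharP R.CoordinateRing p :=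
    charP_of_injective_algebraMap (algebraMap k R.CoordinateRing).injective p
  have h1 := congrArg τ R.coordY_pow_sub
  have h2 : aeval R.coordX ((X * R.poly).comp (C a * X + C c))
      = τ R.coordX * τ (aeval R.coordX R.poly) := by
    rw [algHom_aeval, aeval_comp, hx]
    simp
  rw [map_mul, ← h2, map_sub, map_pow, hy, add_pow_char, mul_pow] at h1
  obtain ⟨h3, h4⟩ := R.eq_zero_of_add_mul_coordY_eq_zero
    (M := C (d ^ p) * (X * R.poly) + G ^ p - G - (X * R.poly).comp (C a * X + C c))
    (N := C (d ^ p - d)) (by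
      have := R.coordY_pow_sub
      simp only [map_sub, map_add, map_mul, map_pow, aeval_C, aeval_X] at h1 ⊢
      linear_combination h1 - algebraMap k R.CoordinateRing d ^ p * this)
  rw [C_eq_zero, sub_eq_zero] at h4
  refine ⟨exists_units_algebraMap_eq hd0 h4, ?_⟩
  rw [h4] at h3
  linear_combination -h3

end AdditivePoly

end ASCurve

namespace ASCurve

namespace AdditivePoly

variable {p : ℕ} [hp : Fact p.Prime] {k : Type*} [Field k] [Algebra (ZMod p) k] [IsAlgClosed k]
  {R : AdditivePoly p k}

/-! ### Automorphisms of the curve that fix the point at infinity -/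

theorem S_iff (hp2 : p ≠ 2) {a : kˣ} {c : k} {d : (ZMod p)ˣ} :
    (a, c, d) ∈ R.S ↔ (a, d) ∈ R.torus ∧ c ∈ R.W := by
  have : CharP k p := charP
  constructor
  · rintro ⟨g, hg⟩
    refine ⟨fun i hi hai => ?_, ?_⟩
    · have := (mul_eq_zero.mp (R.pow_eq_of_eq_pow_sub hp2 hg hi)).resolve_left hai
      exact Units.ext (sub_eq_zero.mp this)
    · obtain ⟨-, B, hB, -⟩ := R.exists_isB_of_eq_pow_sub hp2 a.ne_zero hg
      exact ⟨B, hB⟩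
  · rintro ⟨ht, B, hB⟩
    obtain ⟨b, hb⟩ := exists_pow_sub_eq (p := p) (c * R.poly.eval c)
    refine ⟨_, R.eq_pow_sub_of_isB (fun i hi hai => ?_) hb hB⟩
    exact congrArg Units.val (ht i hi hai)

omit [IsAlgClosed k] in
theorem isOpen_isAffine (hp2 : p ≠ 2) : IsOpen {P : R.CurvePoint | R.IsAffine P} := by
  rw [Point.isOpen_iff]
  intro _
  refine Set.Subsingleton.finite fun P hP P' hP' => ?_
  exact eq_of_not_isAffine hp2 hP hP'

/-- The values of `f` form a regular function on the open affine part. Its pullback is regular at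
all affine points, hence lies in the coordinate ring by `exists_eq_algebraMap`. -/
theorem exists_comp_hom (hp2 : p ≠ 2) {φ : R.CurvePoint → R.CurvePoint}
    (hφ : Point.IsMorphism φ) (hA : ∀ P, R.IsAffine P → R.IsAffine (φ P)) (f : R.CoordinateRing) :
    ∃ f' : R.CoordinateRing, ∀ ε ε' : R.CoordinateRing →ₐ[k] k,
      φ (pointOf ε) = pointOf ε' → ε f' = ε' f := by
  classical
  -- The default value 0 is not taken at affine points, where `f` always has a value.
  let s : R.CurvePoint → k := fun P =>
    if h : ∃ v, P.HasValue (algebraMap _ _ f) v then h.choose else 0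
  have hs : ∀ ε, s (pointOf ε) = ε f := by
    intro ε
    have h : ∃ v, (pointOf ε).HasValue (algebraMap _ R.FunctionField f) v :=
      ⟨_, hasValue_pointOf ε f⟩
    simp only [s, dif_pos h]
    exact h.choose_spec.unique (hasValue_pointOf ε f)
  obtain ⟨z, hz⟩ := hφ.2 _ s (isOpen_isAffine hp2) ⟨algebraMap _ _ f, fun P hP => by
    obtain ⟨ε, rfl⟩ := exists_eq_pointOf hP
    rw [hs]
    exact hasValue_pointOf ε f⟩
  obtain ⟨f', rfl⟩ := exists_eq_algebraMap fun ε =>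
    (hz (pointOf ε) (hA _ (isAffine_pointOf ε))).mem
  refine ⟨f', fun ε ε' h => ?_⟩
  have h1 := hz (pointOf ε) (hA _ (isAffine_pointOf ε))
  rw [Function.comp_apply, h, hs] at h1
  exact eq_of_hasValue_pointOf h1

theorem exists_algHom (hp2 : p ≠ 2) {φ : R.CurvePoint → R.CurvePoint}
    (hφ : Point.IsMorphism φ) (hA : ∀ P, R.IsAffine P → R.IsAffine (φ P)) :
    ∃ τ : R.CoordinateRing →ₐ[k] R.CoordinateRing, ∀ ε, φ (pointOf ε) = pointOf (ε.comp τ) := by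
  obtain ⟨x', hx'⟩ := exists_comp_hom hp2 hφ hA R.coordX
  obtain ⟨y', hy'⟩ := exists_comp_hom hp2 hφ hA R.coordY
  have h : y' ^ p - y' = x' * aeval x' R.poly := by
    rw [← sub_eq_zero]
    refine eq_zero_of_forall_hom fun ε => ?_
    obtain ⟨ε', hε'⟩ := exists_eq_pointOf (hA _ (isAffine_pointOf ε))
    rw [map_sub, map_sub, map_pow, map_mul, ← aeval_algHom_apply, hx' ε ε' hε', hy' ε ε' hε',
      coe_aeval_eq_eval, hom_pow_sub, sub_self]
  refine ⟨R.lift x' y' h, fun ε => ?_⟩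
  obtain ⟨ε', hε'⟩ := exists_eq_pointOf (hA _ (isAffine_pointOf ε))
  rw [hε']
  congr 1
  refine algHom_ext ?_ ?_
  · rw [AlgHom.comp_apply, lift_coordX, hx' ε ε' hε']
  · rw [AlgHom.comp_apply, lift_coordY, hy' ε ε' hε']

theorem exists_algEquiv (hp2 : p ≠ 2) {φ : R.AutCurve}
    (hA : ∀ P, R.IsAffine (φ • P) ↔ R.IsAffine P) :
    ∃ τ : R.CoordinateRing ≃ₐ[k] R.CoordinateRing, ∀ ε,
      φ • pointOf ε = pointOf (ε.comp τ.toAlgHom) := by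
  obtain ⟨τ, hτ⟩ := exists_algHom hp2 φ.2.1 (fun P hP => (hA P).mpr hP)
  obtain ⟨τ', hτ'⟩ := exists_algHom hp2 φ.2.2 (fun P hP => (hA _).mp (by
    change R.IsAffine ((φ : Equiv.Perm R.CurvePoint) ((φ : Equiv.Perm R.CurvePoint).symm P))
    rwa [Equiv.apply_symm_apply]))
  have key : ∀ {τ₁ τ₂ : R.CoordinateRing →ₐ[k] R.CoordinateRing},
      (∀ ε, pointOf ((ε.comp τ₁).comp τ₂) = pointOf (R := R) ε) → τ₁.comp τ₂ = AlgHom.id k _ := by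
    intro τ₁ τ₂ h
    refine AlgHom.ext fun f => sub_eq_zero.mp (eq_zero_of_forall_hom fun ε => ?_)
    have := DFunLike.congr_fun (pointOf_injective (h ε)) f
    rw [map_sub, sub_eq_zero]
    exact this
  refine ⟨AlgEquiv.ofAlgHom τ τ' (key fun ε => ?_) (key fun ε => ?_), hτ⟩
  · rw [← hτ', ← hτ]
    exact Equiv.symm_apply_apply _ _
  · rw [← hτ, ← hτ']
    exact Equiv.apply_symm_apply _ _

theorem isSigma_of_smul_pointOf {a : kˣ} {b c : k} {d : (ZMod p)ˣ} {φ : R.AutCurve}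
    {τ : R.CoordinateRing →ₐ[k] R.CoordinateRing}
    (hτ : ∀ ε, φ • pointOf ε = pointOf (ε.comp τ)) (hS : (a, c, d) ∈ R.S)
    (hb : b ^ p - b = c * R.poly.eval c) {B : k[X]} (hB : R.IsB c B)
    (hx : τ R.coordX = algebraMap k _ a * R.coordX + algebraMap k _ c)
    (hy : τ R.coordY = algebraMap k _ (algebraMap (ZMod p) k d) * R.coordY
      + aeval R.coordX (B.comp (C (a : k) * X) + C b)) :
    R.IsSigma a b c d φ := by
  refine ⟨hS, hb, B, hB, fun P u v hu hv => ?_⟩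
  obtain ⟨ε, rfl⟩ := exists_eq_pointOf ⟨hu.mem, hv.mem⟩
  obtain rfl := eq_of_hasValue_pointOf (f := R.coordX) hu
  obtain rfl := eq_of_hasValue_pointOf (f := R.coordY) hv
  rw [hτ]
  constructor
  · have h1 := hasValue_pointOf (ε.comp τ) R.coordX
    rw [AlgHom.comp_apply, hx, map_add, map_mul, ε.commutes, ε.commutes] at h1
    exact h1
  · have h1 := hasValue_pointOf (ε.comp τ) R.coordY
    rw [AlgHom.comp_apply, hy, map_add, map_mul, ε.commutes, algHom_aeval, coe_aeval_eq_eval,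
      eval_add, eval_comp, eval_mul, eval_C, eval_C, eval_X, add_comm (eval _ B), ← add_assoc] at h1
    exact h1

theorem exists_isSigma (hp2 : p ≠ 2) {φ : R.AutCurve}
    (hA : ∀ P, R.IsAffine (φ • P) ↔ R.IsAffine P) :
    ∃ (a : kˣ) (b c : k) (d : (ZMod p)ˣ), R.IsSigma a b c d φ := by
  have : CharP k p := charP
  obtain ⟨τ, hτ⟩ := exists_algEquiv hp2 hA
  obtain ⟨a, c, d, G, ha, hd, hx, hy⟩ := exists_algEquiv_coord hp2 τ
  obtain ⟨⟨d', rfl⟩, hG⟩ := exists_S_of_algHom hd τ.toAlgHom hx hy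
  obtain ⟨hb, B, hB, hGB⟩ := R.exists_isB_of_eq_pow_sub hp2 ha hG
  refine ⟨Units.mk0 a ha, G.coeff 0, c, d', isSigma_of_smul_pointOf hτ ⟨G, hG⟩ hb hB hx ?_⟩
  rw [Units.val_mk0, ← hGB]
  exact hy

/-- A nonzero kernel, being prime, would be the ideal of a point. The image would then be `k`,
making `x` constant. -/
theorem injective_of_surjective {τ : R.CoordinateRing →ₐ[k] R.CoordinateRing}
    (h : Function.Surjective τ) : Function.Injective τ := by
  rw [← AlgHom.coe_toRingHom, RingHom.injective_iff_ker_eq_bot]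
  by_contra hne
  obtain ⟨ε, hε⟩ := exists_hom_of_isPrime (RingHom.ker_isPrime τ.toRingHom) hne
  obtain ⟨f, hf⟩ := h R.coordX
  refine R.coordX_sub_ne_zero (ε f) ?_
  have h1 : f - algebraMap k _ (ε f) ∈ RingHom.ker τ.toRingHom := by
    rw [hε]
    simp
  have h2 : τ (f - algebraMap k _ (ε f)) = 0 := h1
  rwa [map_sub, hf, τ.commutes] at h2

theorem exists_aut_isSigma (hp2 : p ≠ 2) {a : kˣ} {b c : k} {d : (ZMod p)ˣ}
    (hS : (a, c, d) ∈ R.S) (hb : b ^ p - b = c * R.poly.eval c) :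
    ∃ φ : R.AutCurve, R.IsSigma a b c d φ ∧ ∀ P, ¬ R.IsAffine P → ¬ R.IsAffine (φ • P) := by
  have : CharP k p := charP
  have : CharP R.CoordinateRing p :=
    charP_of_injective_algebraMap (algebraMap k R.CoordinateRing).injective p
  obtain ⟨ht, B, hB⟩ := (S_iff hp2).mp hS
  have hG := R.eq_pow_sub_of_isB (a := a) (d := algebraMap (ZMod p) k d)
    (fun i hi hai => congrArg Units.val (ht i hi hai)) hb hB
  set G := B.comp (C (a : k) * X) + C b with hGdef
  set D := algebraMap (ZMod p) k d with hD
  let x' := algebraMap k R.CoordinateRing a * R.coordX + algebraMap k _ c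
  let y' := algebraMap k R.CoordinateRing D * R.coordY + aeval R.coordX G
  have h : y' ^ p - y' = x' * aeval x' R.poly := by
    have h1 := congrArg (aeval R.coordX) hG
    have h2 : aeval R.coordX ((X * R.poly).comp (C (a : k) * X + C c)) = x' * aeval x' R.poly := by
      rw [aeval_comp]
      simp [x']
    rw [map_sub, h2] at h1
    simp only [map_sub, map_mul, map_pow, aeval_C, aeval_X] at h1
    have h3 := R.coordY_pow_sub
    have h4 : algebraMap k R.CoordinateRing D ^ p = algebraMap k R.CoordinateRing D := by
      rw [← map_pow, hD, algebraMap_pow_prime]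
    simp only [y']
    rw [add_pow_char, mul_pow, h4]
    linear_combination algebraMap k R.CoordinateRing D * h3 - h1
  let τ := R.lift x' y' h
  have hx : τ R.coordX = x' := R.lift_coordX h
  have hy : τ R.coordY = y' := R.lift_coordY h
  have hsurj : Function.Surjective τ := by
    rw [← AlgHom.range_eq_top, eq_top_iff, ← R.adjoin_coord, Algebra.adjoin_le_iff]
    have hxr : R.coordX ∈ τ.range := by
      have h1 : x' ∈ τ.range := ⟨_, hx⟩
      have h2 := mul_mem (Subalgebra.algebraMap_mem τ.range (a⁻¹ : kˣ).val)
        (sub_mem h1 (Subalgebra.algebraMap_mem τ.range c))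
      simp only [x'] at h2
      rwa [add_sub_cancel_right, ← mul_assoc, ← map_mul, Units.inv_mul, map_one, one_mul] at h2
    have hyr : R.coordY ∈ τ.range := by
      have h1 : y' ∈ τ.range := ⟨_, hy⟩
      have h3 : aeval R.coordX G ∈ τ.range :=
        Algebra.adjoin_le (Set.singleton_subset_iff.mpr hxr) (aeval_mem_adjoin_singleton k R.coordX)
      have hD0 : D ≠ 0 := by
        rw [hD, Ne, map_eq_zero_iff _ (algebraMap (ZMod p) k).injective]
        exact d.ne_zero
      have h2 := mul_mem (Subalgebra.algebraMap_mem τ.range D⁻¹) (sub_mem h1 h3)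
      simp only [y'] at h2
      rwa [add_sub_cancel_right, ← mul_assoc, ← map_mul, inv_mul_cancel₀ hD0, map_one,
        one_mul] at h2
    rintro z (rfl | rfl)
    exacts [hxr, hyr]
  let σ := AlgEquiv.ofBijective τ ⟨injective_of_surjective hsurj, hsurj⟩
  refine ⟨Point.autOf (fieldAut σ), ?_, fun P hP => not_isAffine_pullback σ hP⟩
  refine isSigma_of_smul_pointOf (τ := τ) (fun ε => ?_) hS hb hB hx hy
  refine eq_pointOf fun f => ?_
  rw [Point.autOf_smul, Point.hasValue_pullback, fieldAut_algebraMap]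
  exact hasValue_pointOf ε (τ f)

/-! ### The parameters of an automorphism -/

/-- The values of the coordinate functions at the images of the affine points. -/
theorem IsSigma.exists_smul_pointOf {a : kˣ} {b c : k} {d : (ZMod p)ˣ} {φ : R.AutCurve}
    (h : R.IsSigma a b c d φ) (ε : R.CoordinateRing →ₐ[k] k) :
    ∃ ε' : R.CoordinateRing →ₐ[k] k, φ • pointOf ε = pointOf ε' ∧
      ε' R.coordX = a * ε R.coordX + c ∧
      ∃ B, R.IsB c B ∧
      ε' R.coordY = algebraMap (ZMod p) k d * ε R.coordY + b + B.eval (a * ε R.coordX) := by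
  obtain ⟨-, -, B, hB, h⟩ := h
  obtain ⟨hx, hy⟩ := h (pointOf ε) _ _ (hasValue_pointOf ε R.coordX) (hasValue_pointOf ε R.coordY)
  obtain ⟨ε', hε'⟩ := exists_eq_pointOf ⟨hx.mem, hy.mem⟩
  rw [hε'] at hx hy
  exact ⟨ε', hε', eq_of_hasValue_pointOf (f := R.coordX) hx, B, hB,
    eq_of_hasValue_pointOf (f := R.coordY) hy⟩

omit hp [Algebra (ZMod p) k] [IsAlgClosed k] in
theorem IsB.eval_zero {c : k} {B : k[X]} (hB : R.IsB c B) : B.eval 0 = 0 := by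
  rw [← coeff_zero_eq_eval_zero]
  exact X_dvd_iff.mp hB.1

variable (R) in
/-- The point with `x = 0` and `y = s`, for `s` in the prime field. -/
noncomputable def homZero (s : ZMod p) : R.CoordinateRing →ₐ[k] k :=
  R.lift 0 (algebraMap (ZMod p) k s) (by rw [algebraMap_pow_prime, sub_self, zero_mul])

omit [IsAlgClosed k] in
theorem homZero_coordX (s : ZMod p) : R.homZero s R.coordX = 0 := R.lift_coordX _

omit [IsAlgClosed k] in
theorem homZero_coordY (s : ZMod p) : R.homZero s R.coordY = algebraMap (ZMod p) k s :=
  R.lift_coordY _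

theorem IsSigma.exists_smul_homZero {a : kˣ} {b c : k} {d : (ZMod p)ˣ} {φ : R.AutCurve}
    (h : R.IsSigma a b c d φ) (s : ZMod p) :
    ∃ ε' : R.CoordinateRing →ₐ[k] k, φ • pointOf (R.homZero s) = pointOf ε' ∧
      ε' R.coordX = c ∧ ε' R.coordY = algebraMap (ZMod p) k (d * s) + b := by
  obtain ⟨ε', hε', hx, B, hB, hy⟩ := h.exists_smul_pointOf (R.homZero s)
  refine ⟨ε', hε', ?_, ?_⟩
  · rw [hx, homZero_coordX, mul_zero, zero_add]
  · rw [hy, homZero_coordX, mul_zero, hB.eval_zero, add_zero, homZero_coordY, map_mul]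

/-- Comparing `x`-coordinates of images of points over `x = 0` and `x = 1` isolates `a`. Comparing
`y`-coordinates of images of `(0, 0)` and `(0, 1)` isolates `d`, as the terms from `b` and `B_c`
cancel. -/
theorem IsSigma.params_mul {a a' a'' : kˣ} {b b' b'' c c' c'' : k} {d d' d'' : (ZMod p)ˣ}
    {φ φ' : R.AutCurve} (h : R.IsSigma a b c d φ) (h' : R.IsSigma a' b' c' d' φ')
    (h'' : R.IsSigma a'' b'' c'' d'' (φ * φ')) : a'' = a * a' ∧ d'' = d * d' := by
  have : CharP k p := charP
  have hX : ∀ u : k, a'' * u + c'' = a * (a' * u + c') + c := by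
    intro u
    obtain ⟨ε, rfl⟩ := R.exists_hom_coordX u
    obtain ⟨ε₁, h₁, hx₁, -⟩ := h'.exists_smul_pointOf ε
    obtain ⟨ε₂, h₂, hx₂, -⟩ := h.exists_smul_pointOf ε₁
    obtain ⟨ε₃, h₃, hx₃, -⟩ := h''.exists_smul_pointOf ε
    rw [mul_smul, h₁, h₂] at h₃
    obtain rfl := pointOf_injective h₃
    rw [← hx₃, hx₂, hx₁]
  have hY : ∀ s : ZMod p, ∃ B, R.IsB c B ∧ algebraMap (ZMod p) k (d'' * s) + b''
      = algebraMap (ZMod p) k d * (algebraMap (ZMod p) k (d' * s) + b') + b + B.eval (a * c') := by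
    intro s
    obtain ⟨ε₁, h₁, hx₁, hy₁⟩ := h'.exists_smul_homZero s
    obtain ⟨ε₂, h₂, hx₂, B, hB, hy₂⟩ := h.exists_smul_pointOf ε₁
    obtain ⟨ε₃, h₃, hx₃, hy₃⟩ := h''.exists_smul_homZero s
    rw [mul_smul, h₁, h₂] at h₃
    obtain rfl := pointOf_injective h₃
    exact ⟨B, hB, by rw [← hy₃, hy₂, hy₁, hx₁]⟩
  constructor
  · have h0 := hX 0
    have h1 := hX 1
    refine Units.ext ?_
    rw [Units.val_mul]
    linear_combination h1 - h0
  · obtain ⟨B₀, hB₀, h0⟩ := hY 0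
    obtain ⟨B₁, hB₁, h1⟩ := hY 1
    rw [IsB.unique R hB₁ hB₀] at h1
    refine Units.ext ((algebraMap (ZMod p) k).injective ?_)
    rw [Units.val_mul, map_mul]
    simp only [mul_one, mul_zero, map_zero] at h0 h1
    linear_combination h1 - h0

theorem IsSigma.params_unique {a a' : kˣ} {b b' c c' : k} {d d' : (ZMod p)ˣ}
    {φ : R.AutCurve} (h : R.IsSigma a b c d φ) (h' : R.IsSigma a' b' c' d' φ) :
    a = a' ∧ b = b' ∧ c = c' ∧ d = d' := by
  obtain ⟨ε₁, h₁, hx₁, hy₁⟩ := h.exists_smul_homZero 0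
  obtain ⟨ε₁', h₁', hx₁', hy₁'⟩ := h'.exists_smul_homZero 0
  obtain ⟨ε₂, h₂, hx₂, hy₂⟩ := h.exists_smul_homZero 1
  obtain ⟨ε₂', h₂', hx₂', hy₂'⟩ := h'.exists_smul_homZero 1
  obtain ⟨ε, hε⟩ := R.exists_hom_coordX (1 : k)
  obtain ⟨ε₃, h₃, hx₃, -⟩ := h.exists_smul_pointOf ε
  obtain ⟨ε₃', h₃', hx₃', -⟩ := h'.exists_smul_pointOf ε
  obtain rfl := pointOf_injective (h₁.symm.trans h₁')
  obtain rfl := pointOf_injective (h₂.symm.trans h₂')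
  obtain rfl := pointOf_injective (h₃.symm.trans h₃')
  rw [mul_zero, map_zero, zero_add] at hy₁ hy₁'
  rw [hε, mul_one] at hx₃ hx₃'
  have hb : b = b' := hy₁.symm.trans hy₁'
  have hc : c = c' := hx₁.symm.trans hx₁'
  refine ⟨Units.ext ?_, hb, hc, Units.ext ((algebraMap (ZMod p) k).injective ?_)⟩
  · linear_combination hx₃' - hx₃ - hc
  · rw [mul_one] at hy₂ hy₂'
    linear_combination hy₂' - hy₂ - hb

theorem IsSigma.eq_of_isSigma {Q : R.CurvePoint} (hQ : ∀ P, ¬ R.IsAffine P ↔ P = Q)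
    {a : kˣ} {b c : k} {d : (ZMod p)ˣ} {φ φ' : R.AutFixing Q} (h : R.IsSigma a b c d φ)
    (h' : R.IsSigma a b c d φ') : φ = φ' := by
  have : CharP k p := charP
  refine Subtype.ext (Subtype.ext (Equiv.ext fun P => ?_))
  change (φ : R.AutCurve) • P = (φ' : R.AutCurve) • P
  by_cases hP : R.IsAffine P
  · obtain ⟨ε, rfl⟩ := exists_eq_pointOf hP
    obtain ⟨ε₁, h₁, hx₁, B, hB, hy₁⟩ := h.exists_smul_pointOf ε
    obtain ⟨ε₂, h₂, hx₂, B', hB', hy₂⟩ := h'.exists_smul_pointOf ε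
    rw [IsB.unique R hB hB'] at hy₁
    rw [h₁, h₂]
    congr 1
    exact algHom_ext (hx₁.trans hx₂.symm) (hy₁.trans hy₂.symm)
  · obtain rfl := (hQ P).mp hP
    exact φ.2.trans φ'.2.symm

end AdditivePoly

end ASCurve

namespace ASCurve

namespace AdditivePoly

variable {p : ℕ} [hp : Fact p.Prime] {k : Type*} [Field k] [Algebra (ZMod p) k] [IsAlgClosed k]
  {R : AdditivePoly p k} {Q : R.CurvePoint}

/-! ### The structure of the group of automorphisms that fix the point at infinity -/

omit [IsAlgClosed k] in
theorem isAffine_smul_iff (hQ : ∀ P, ¬ R.IsAffine P ↔ P = Q) (φ : R.AutFixing Q)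
    (P : R.CurvePoint) : R.IsAffine ((φ : R.AutCurve) • P) ↔ R.IsAffine P := by
  have hφ : (φ : R.AutCurve) • Q = Q := φ.2
  rw [← not_iff_not, hQ, hQ]
  constructor
  · intro h
    exact MulAction.injective (φ : R.AutCurve) (h.trans hφ.symm)
  · rintro rfl
    exact hφ

theorem exists_isSigma_autFixing (hp2 : p ≠ 2) (hQ : ∀ P, ¬ R.IsAffine P ↔ P = Q)
    (φ : R.AutFixing Q) : ∃ (t : kˣ × (ZMod p)ˣ) (b c : k), R.IsSigma t.1 b c t.2 φ := by
  obtain ⟨a, b, c, d, h⟩ := exists_isSigma hp2 (isAffine_smul_iff hQ φ)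
  exact ⟨(a, d), b, c, h⟩

theorem exists_autFixing_isSigma (hp2 : p ≠ 2) (hQ : ∀ P, ¬ R.IsAffine P ↔ P = Q) {a : kˣ}
    {b c : k} {d : (ZMod p)ˣ} (ht : (a, d) ∈ R.torus) (hc : c ∈ R.W)
    (hb : b ^ p - b = c * R.poly.eval c) : ∃ φ : R.AutFixing Q, R.IsSigma a b c d φ := by
  obtain ⟨φ, hφ, hA⟩ := exists_aut_isSigma hp2 ((S_iff hp2).mpr ⟨ht, hc⟩) hb
  exact ⟨⟨φ, (hQ _).mp (hA Q ((hQ Q).mpr rfl))⟩, hφ⟩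

/-- The homomorphism that sends `σ_{a,b,c,d}` to `(a, d)`. -/
noncomputable def toTorus (hp2 : p ≠ 2) (hQ : ∀ P, ¬ R.IsAffine P ↔ P = Q) :
    R.AutFixing Q →* kˣ × (ZMod p)ˣ :=
  MonoidHom.mk' (fun φ => (exists_isSigma_autFixing hp2 hQ φ).choose) fun φ φ' => by
    obtain ⟨b, c, h⟩ := (exists_isSigma_autFixing hp2 hQ φ).choose_spec
    obtain ⟨b', c', h'⟩ := (exists_isSigma_autFixing hp2 hQ φ').choose_spec
    obtain ⟨b'', c'', h''⟩ := (exists_isSigma_autFixing hp2 hQ (φ * φ')).choose_spec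
    obtain ⟨h1, h2⟩ := IsSigma.params_mul h h' h''
    exact Prod.ext h1 h2

variable (hp2 : p ≠ 2) (hQ : ∀ P, ¬ R.IsAffine P ↔ P = Q)

include hp2 hQ in
theorem exists_isSigma_toTorus (φ : R.AutFixing Q) :
    ∃ b c : k, R.IsSigma (toTorus hp2 hQ φ).1 b c (toTorus hp2 hQ φ).2 φ :=
  (exists_isSigma_autFixing hp2 hQ φ).choose_spec

theorem toTorus_eq {φ : R.AutFixing Q} {a : kˣ} {b c : k} {d : (ZMod p)ˣ}
    (h : R.IsSigma a b c d φ) : toTorus hp2 hQ φ = (a, d) := by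
  obtain ⟨b', c', h'⟩ := exists_isSigma_toTorus hp2 hQ φ
  obtain ⟨h1, -, -, h2⟩ := h'.params_unique h
  exact Prod.ext h1 h2

theorem toTorus_mem (φ : R.AutFixing Q) : toTorus hp2 hQ φ ∈ R.torus := by
  obtain ⟨b, c, h⟩ := exists_isSigma_toTorus hp2 hQ φ
  exact ((S_iff hp2).mp h.1).1

theorem mem_ker_toTorus {φ : R.AutFixing Q} :
    φ ∈ (toTorus hp2 hQ).ker ↔ ∃ b c : k, R.IsSigma 1 b c 1 φ := by
  constructor
  · intro h
    have h1 : toTorus hp2 hQ φ = 1 := h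
    have h2 := exists_isSigma_toTorus hp2 hQ φ
    rwa [h1] at h2
  · rintro ⟨b, c, h⟩
    exact toTorus_eq hp2 hQ h

/-- `(b, c) ↦ σ_{1,b,c,1}` is a bijection from the pairs counted in `card_translations` onto the
kernel. -/
theorem card_ker_toTorus : Nat.card (toTorus hp2 hQ).ker = p ^ (2 * R.h + 1) := by
  have : CharP k p := charP
  rw [← R.card_translations hp2]
  have hex : ∀ t : {t : k × k // t.1 ^ p - t.1 = t.2 * R.poly.eval t.2 ∧ t.2 ∈ R.W},
      ∃ φ : R.AutFixing Q, R.IsSigma 1 t.1.1 t.1.2 1 φ := fun t =>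
    exists_autFixing_isSigma hp2 hQ R.torus.one_mem t.2.2 t.2.1
  choose Φ hΦ using hex
  symm
  refine Nat.card_eq_of_bijective
    (fun t => (⟨Φ t, (mem_ker_toTorus hp2 hQ).mpr ⟨_, _, hΦ t⟩⟩ : (toTorus hp2 hQ).ker)) ⟨?_, ?_⟩
  · intro t t' h
    have h1 : Φ t = Φ t' := congrArg Subtype.val h
    have h2 := hΦ t'
    rw [← h1] at h2
    obtain ⟨-, hb, hc, -⟩ := (hΦ t).params_unique h2
    exact Subtype.ext (Prod.ext hb hc)
  · rintro ⟨φ, hφ⟩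
    obtain ⟨b, c, h⟩ := (mem_ker_toTorus hp2 hQ).mp hφ
    refine ⟨⟨(b, c), h.2.1, ((S_iff hp2).mp h.1).2⟩, Subtype.ext ?_⟩
    exact (hΦ ⟨(b, c), h.2.1, ((S_iff hp2).mp h.1).2⟩).eq_of_isSigma hQ h

variable (R Q) in
/-- The automorphisms that fix the point at infinity and the point `(0, 0)`. -/
noncomputable def diagonal : Subgroup (R.AutFixing Q) :=
  MulAction.stabilizer (R.AutFixing Q) (pointOf (R.homZero 0))

theorem IsSigma.mem_diagonal_iff {φ : R.AutFixing Q} {a : kˣ} {b c : k} {d : (ZMod p)ˣ}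
    (h : R.IsSigma a b c d φ) : φ ∈ R.diagonal Q ↔ b = 0 ∧ c = 0 := by
  obtain ⟨ε, hε, hx, hy⟩ := h.exists_smul_homZero 0
  rw [mul_zero, map_zero, zero_add] at hy
  have h1 : φ ∈ R.diagonal Q ↔ pointOf ε = pointOf (R.homZero 0) := by
    rw [← hε]
    rfl
  rw [h1, pointOf_injective.eq_iff]
  constructor
  · rintro rfl
    rw [homZero_coordX] at hx
    rw [homZero_coordY, map_zero] at hy
    exact ⟨hy.symm, hx.symm⟩
  · rintro ⟨rfl, rfl⟩
    refine algHom_ext ?_ ?_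
    · rw [hx, homZero_coordX]
    · rw [hy, homZero_coordY, map_zero]

include hp2 hQ in
theorem mem_diagonal {φ : R.AutFixing Q} :
    φ ∈ R.diagonal Q ↔ ∃ (a : kˣ) (d : (ZMod p)ˣ), R.IsSigma a 0 0 d φ := by
  constructor
  · intro h
    obtain ⟨b, c, hs⟩ := exists_isSigma_toTorus hp2 hQ φ
    obtain ⟨rfl, rfl⟩ := hs.mem_diagonal_iff.mp h
    exact ⟨_, _, hs⟩
  · rintro ⟨a, d, h⟩
    exact h.mem_diagonal_iff.mpr ⟨rfl, rfl⟩

theorem eq_of_toTorus_eq {φ φ' : R.AutFixing Q} (hφ : φ ∈ R.diagonal Q) (hφ' : φ' ∈ R.diagonal Q)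
    (h : toTorus hp2 hQ φ = toTorus hp2 hQ φ') : φ = φ' := by
  obtain ⟨a, d, hs⟩ := (mem_diagonal hp2 hQ).mp hφ
  obtain ⟨a', d', hs'⟩ := (mem_diagonal hp2 hQ).mp hφ'
  rw [toTorus_eq hp2 hQ hs, toTorus_eq hp2 hQ hs', Prod.mk.injEq] at h
  obtain ⟨rfl, rfl⟩ := h
  exact hs.eq_of_isSigma hQ hs'

theorem exists_mem_diagonal {t : kˣ × (ZMod p)ˣ} (ht : t ∈ R.torus) :
    ∃ φ ∈ R.diagonal Q, toTorus hp2 hQ φ = t := by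
  obtain ⟨φ, hφ⟩ := exists_autFixing_isSigma hp2 hQ (a := t.1) (d := t.2) (b := 0) (c := 0) ht
    ⟨0, R.isB_zero⟩ (by simp [hp.out.ne_zero])
  exact ⟨φ, (mem_diagonal hp2 hQ).mpr ⟨_, _, hφ⟩, toTorus_eq hp2 hQ hφ⟩

include hp2 hQ in
theorem card_diagonal : Nat.card (R.diagonal Q) = Nat.card R.torus := by
  refine Nat.card_eq_of_bijective
    (fun φ => (⟨toTorus hp2 hQ φ, toTorus_mem hp2 hQ φ⟩ : R.torus)) ⟨?_, ?_⟩
  · intro φ φ' h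
    exact Subtype.ext (eq_of_toTorus_eq hp2 hQ φ.2 φ'.2 (congrArg Subtype.val h))
  · rintro ⟨t, ht⟩
    obtain ⟨φ, hφ, h⟩ := exists_mem_diagonal hp2 hQ ht
    exact ⟨⟨φ, hφ⟩, Subtype.ext h⟩

-- The first coordinate of `toTorus` embeds this finite group in `k^*`.
include hp2 hQ in
theorem isCyclic_diagonal : IsCyclic (R.diagonal Q) := by
  have : Finite (R.diagonal Q) := Nat.finite_of_card_ne_zero fun h => by
    rw [card_diagonal hp2 hQ] at h
    exact R.not_dvd_card_torus hp2 (h ▸ dvd_zero p)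
  refine isCyclic_of_injective_ringHom ((Units.coeHom k).comp ((MonoidHom.fst kˣ (ZMod p)ˣ).comp
    ((toTorus hp2 hQ).comp (R.diagonal Q).subtype))) fun φ φ' h => ?_
  have h1 : (toTorus hp2 hQ φ).1 = (toTorus hp2 hQ φ').1 := Units.ext h
  exact Subtype.ext (eq_of_toTorus_eq hp2 hQ φ.2 φ'.2
    (R.eq_of_mem_torus (toTorus_mem hp2 hQ φ) (toTorus_mem hp2 hQ φ') h1))

theorem isComplement'_ker_toTorus_diagonal :
    Subgroup.IsComplement' (toTorus hp2 hQ).ker (R.diagonal Q) := by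
  refine Subgroup.isComplement'_of_disjoint_and_mul_eq_univ ?_ ?_
  · rw [Subgroup.disjoint_def]
    intro φ h1 h2
    refine eq_of_toTorus_eq hp2 hQ h2 (one_mem _) ?_
    rw [map_one]
    exact h1
  · refine Set.eq_univ_iff_forall.mpr fun φ => ?_
    -- `η` is the diagonal automorphism with the same `(a, d)` as `φ`, so `φ η⁻¹` lies in the
    -- kernel.
    obtain ⟨η, hη, h⟩ := exists_mem_diagonal hp2 hQ (toTorus_mem hp2 hQ φ)
    refine ⟨φ * η⁻¹, ?_, η, hη, inv_mul_cancel_right φ η⟩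
    rw [SetLike.mem_coe, MonoidHom.mem_ker, map_mul, map_inv, h, mul_inv_cancel]

end AdditivePoly

end ASCurve

theorem mainTheorem7 {p : ℕ} [Fact p.Prime] (hp : p ≠ 2) {k : Type*} [Field k]
    [Algebra (ZMod p) k] [IsAlgClosure (ZMod p) k] (R : ASCurve.AdditivePoly p k) :
    ∃ Q : R.CurvePoint, (∀ P : R.CurvePoint, ¬ R.IsAffine P ↔ P = Q) ∧
      ∃ P : Sylow p (R.AutFixing Q),
        (∀ P' : Sylow p (R.AutFixing Q), P' = P) ∧
        (∀ φ : R.AutFixing Q, φ ∈ P ↔ ∃ b c : k, R.IsSigma 1 b c 1 φ) ∧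
        Nat.card P = p ^ (2 * R.h + 1) ∧
        ∃ H : Subgroup (R.AutFixing Q),
          (∀ φ : R.AutFixing Q, φ ∈ H ↔ ∃ (a : kˣ) (d : (ZMod p)ˣ), R.IsSigma a 0 0 d φ) ∧
          IsCyclic H ∧
          Nat.card H = R.e * (p - 1) / 2 * R.gcdExp ∧
          (P : Subgroup (R.AutFixing Q)).Normal ∧
          Subgroup.IsComplement' (P : Subgroup (R.AutFixing Q)) H := by
  have : IsAlgClosed k := IsAlgClosure.isAlgClosed (ZMod p)
  have hp0 : p.Prime := Fact.out
  obtain ⟨Q, hQ0⟩ := R.exists_not_isAffine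
  have hQ : ∀ P : R.CurvePoint, ¬ R.IsAffine P ↔ P = Q := fun P =>
    ⟨fun h => ASCurve.AdditivePoly.eq_of_not_isAffine hp h hQ0, fun h => h ▸ hQ0⟩
  have hcompl := ASCurve.AdditivePoly.isComplement'_ker_toTorus_diagonal hp hQ
  have hcard := ASCurve.AdditivePoly.card_ker_toTorus hp hQ
  have hindex : (ASCurve.AdditivePoly.toTorus hp hQ).ker.index = Nat.card R.torus := by
    rw [hcompl.symm.index_eq_card, ASCurve.AdditivePoly.card_diagonal hp hQ]
  have hdvd : ¬ p ∣ (ASCurve.AdditivePoly.toTorus hp hQ).ker.index :=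
    hindex ▸ R.not_dvd_card_torus hp
  have hfin : Finite (R.AutFixing Q) := Nat.finite_of_card_ne_zero (by
    rw [← (ASCurve.AdditivePoly.toTorus hp hQ).ker.card_mul_index, hcard]
    exact mul_ne_zero (pow_ne_zero _ hp0.ne_zero) fun h => hdvd (h ▸ dvd_zero p))
  -- A `p`-subgroup of index prime to `p` is Sylow. Being a kernel it is normal, hence the only
  -- Sylow `p`-subgroup.
  let S : Sylow p (R.AutFixing Q) := (IsPGroup.of_card hcard).toSylow hdvd
  have hnormal : (S : Subgroup (R.AutFixing Q)).Normal :=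
    inferInstanceAs (ASCurve.AdditivePoly.toTorus hp hQ).ker.Normal
  refine ⟨Q, hQ, S, fun P' => ?_, fun φ => ASCurve.AdditivePoly.mem_ker_toTorus hp hQ, hcard,
    R.diagonal Q, fun φ => ASCurve.AdditivePoly.mem_diagonal hp hQ,
    ASCurve.AdditivePoly.isCyclic_diagonal hp hQ, ?_, hnormal, hcompl⟩
  · have := S.unique_of_normal hnormal
    exact Subsingleton.elim _ _
  · rw [ASCurve.AdditivePoly.card_diagonal hp hQ, R.card_torus hp]
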